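/- **Theorem 1.3 (cutoff-window profiles for colored top-$m$-to-random).** For integers $n,p\ge 1$ let $G_{n,p}=C_p\wr S_n$ be the group of $p$-colored permutations, realized as $(\mathbb Z/p)^n\times S_n$ with multiplication $(t,\tau)(s,\sigma)=(\sigma t+s,\tau\sigma)$, $\sigma t=(t_{\sigma(1)},\dots,t_{\sigma(n)})$; the element $(s,\sigma)$ is the deck whose $i$-th card has label $\sigma(i)$ and color $s_i$. Let $U$ be the uniform law on $G_{n,p}$. For $1\le m\le n$ let $Q^{(m)}$ be the uniform law on the set of colored permutations in which the labels $m+1,\dots,n$ appear in increasing order and all have color $0$, and let $(Q^{(m)})^{*k}$ be its $k$-th convolution power, where $(M*N)(z)=\sum_{u}M(zu^{-1})N(u)$ (the law after $k$ steps of colored top-$m$-to-random started at the identity). For a law $M$ on $G_{n,p}$ put $$\|M-U\|_{\mathrm{TV}}=\tfrac12\sum_x|M(x)-U(x)|,\quad \mathrm{sep}(M,U)=1-\min_x\frac{M(x)}{U(x)},\quad D(M\|U)=\sum_xM(x)\log\frac{M(x)}{U(x)},$$ $$\|f\|_{L^q(U)}=\Bigl(\sum_x|f(x)|^qU(x)\Bigr)^{1/q}\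 (1\le q<\infty),\quad \|f\|_{L^\infty(U)}=\max_x|f(x)|,\quad \chi^2(M,U)=\Bigl\|\frac MU-1\Bigr\|_{L^2(U)}^2 .$$ For $c\in\mathbb R$ and $p\ge1$ write $\lambda=e^{-c}$, $r=p\lambda$, $s(\ell)=e^{-\lambda}\sum_{u=0}^{\ell}r^u$, $a_\ell=\frac1{\ell!\,p^\ell}-\frac1{(\ell+1)!\,p^{\ell+1}}$, $w^*=\min\{\ell\ge0:s(\ell)>1\}$, and $$f_p(c)=1-e^{-\lambda}\sum_{u=0}^{w^*-1}\frac{\lambda^u}{u!}+\frac{e^{-\lambda}\sum_{u=0}^{w^*-1}r^u-1}{w^*!\,p^{w^*}},\qquad s_p(c)=\begin{cases}1-e^{-\lambda}(1+\lambda),&p=1,\\1-e^{-\lambda},&p\ge2,\end{cases}$$ $$H_{q,p}(c)=\sum_{\ell=0}^\infty a_\ell|s(\ell)-1|^q\ (1\le q<\infty),\qquad h_p(c)=\sum_{\ell=0}^\infty a_\ell\,s(\ell)\log s(\ell),$$ $$g_p(c)=\begin{cases}\frac{r+1}{r-1}e^{-\lambda(2-r)}-\frac2{r-1}e^{-\lambda}-1,&r\ne1,\\(2\lambda+1)e^{-\lambda}-1,&r=1,\end{cases}\qquad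 H_{\infty,p}(c)=\begin{cases}\frac{e^{-\lambda}}{1-r}-1,&r<1,\\+\infty,&r\ge1.\end{cases}$$ Fix integers $p\ge1$ and $m\ge1$. Then for every $c\in\mathbb R$, with $k=k_n(c)=\lfloor\frac nm(\log n+c)\rfloor$, the series defining $H_{q,p}(c)$ ($1\le q<\infty$) and $h_p(c)$ converge, $H_{2,p}(c)=g_p(c)$, and as $n\to\infty$ $$\mathrm{sep}\bigl((Q^{(m)})^{*k},U\bigr)\to s_p(c),\qquad \Bigl\|\frac{(Q^{(m)})^{*k}}{U}-1\Bigr\|_{L^q(U)}^q\to H_{q,p}(c)\quad(1\le q<\infty),$$ $$D\bigl((Q^{(m)})^{*k}\|U\bigr)\to h_p(c),\qquad \Bigl\|\frac{(Q^{(m)})^{*k}}{U}-1\Bigr\|_{L^\infty(U)}\to H_{\infty,p}(c),$$ $$\bigl\|(Q^{(m)})^{*k}-U\bigr\|_{\mathrm{TV}}\to f_p(c),\qquad \chi^2\bigl((Q^{(m)})^{*k},U\bigr)\to g_p(c).$$ Consequently the walk has a total-variation cutoff at times $t_n=\frac nm\log n$ with window $b_n=\frac nm$: there is a nonincreasing $f:\mathbb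 R\to[0,1]$ with $f(c)\to1$ as $c\to-\infty$ and $f(c)\to0$ as $c\to+\infty$ such that $\|(Q^{(m)})^{*\lfloor t_n+cb_n\rfloor}-U\|_{\mathrm{TV}}\to f(c)$ for every fixed $c\in\mathbb R$. -/

import Mathlib

open Filter Topology

namespace ColoredShuffle

noncomputable section

/-! ### Laws on a finite group -/

section Laws

variable {X : Type*} [Fintype X]

/-- The uniform law on a finite type. -/
def unif (X : Type*) [Fintype X] : X → ℝ := fun _ => 1 / (Fintype.card X : ℝ)

/-- The uniform law on a subset `A` of a finite type. -/
def unifOn (A : Set X) : X → ℝ := A.indicator fun _ => 1 / (A.ncard : ℝ)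

/-- Convolution of laws: `(M * N)(z) = ∑ u, M (z u⁻¹) N u`, the law of `G H` for independent
`G ∼ M` and `H ∼ N`. -/
def convol [Group X] (M N : X → ℝ) : X → ℝ := fun z => ∑ u, M (z * u⁻¹) * N u

open Classical in
/-- The `k`-th convolution power `Q^{*k}`, the law after `k` steps of the right random walk
started at the identity. -/
def convPow [Group X] (Q : X → ℝ) : ℕ → X → ℝ
  | 0 => fun z => if z = 1 then 1 else 0
  | k + 1 => convol (convPow Q k) Q

/-- Total-variation distance. -/
def tvDist (M N : X → ℝ) : ℝ := (1 / 2) * ∑ x, |M x - N x|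

/-- Separation `1 - min_x M x / U x`. -/
def sep (M U : X → ℝ) : ℝ := 1 - ⨅ x, M x / U x

/-- The `L^q(U)` norm for finite `q`. -/
def lqNorm (U : X → ℝ) (q : ℝ) (f : X → ℝ) : ℝ := (∑ y, |f y| ^ q * U y) ^ (1 / q)

/-- The `L^∞(U)` norm `max_y |f y|` (for the uniform law `U`). -/
def linfNorm (f : X → ℝ) : ℝ := ⨆ y, |f y|

/-- The relative density minus one, `M(·)/U(·) - 1`. -/
def relDev (M U : X → ℝ) : X → ℝ := fun x => M x / U x - 1

/-- The chi-squared distance `‖M/U - 1‖²` in `L²(U)`. -/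
def chiSq (M U : X → ℝ) : ℝ := lqNorm U 2 (relDev M U) ^ 2

/-- Relative entropy `∑ x, M x log (M x / U x)` (with `0 log 0 = 0`). -/
def relEnt (M U : X → ℝ) : ℝ := ∑ x, M x * Real.log (M x / U x)

end Laws

/-- Let `d n k` be the total-variation distance to stationarity of the `n`-th chain after `k`
steps. There is a cutoff at times `t n` with window `b n` if `d n ⌊t n + c * b n⌋` converges, for
every fixed `c`, to `f c`, for some nonincreasing `f : ℝ → [0,1]` going from `1` at `-∞` to `0`
at `+∞`. -/
def HasCutoff (d : ℕ → ℕ → ℝ) (t b : ℕ → ℝ) : Prop :=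
  ∃ f : ℝ → ℝ, Antitone f ∧ (∀ c, f c ∈ Set.Icc (0 : ℝ) 1) ∧
    Tendsto f atBot (𝓝 1) ∧ Tendsto f atTop (𝓝 0) ∧
    ∀ c : ℝ, Tendsto (fun n : ℕ => d n ⌊t n + c * b n⌋₊) atTop (𝓝 (f c))

/-! ### Colored permutations -/

/-- The colored permutations `G_{n,p} = C_p ≀ S_n`. The element `(s, σ)` is the deck of `n`
cards in which position `i` carries the label `σ i` with color `s i`. -/
@[ext]
structure ColPerm (n p : ℕ) where
  color : Fin n → ZMod p
  perm : Equiv.Perm (Fin n)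

namespace ColPerm

variable {n p : ℕ}

/-- `(t, τ) (s, σ) = (σ t + s, τ σ)` with `σ t = (t_{σ 1}, …, t_{σ n})`. -/
instance : Mul (ColPerm n p) :=
  ⟨fun x y => ⟨fun i => x.color (y.perm i) + y.color i, x.perm * y.perm⟩⟩

instance : One (ColPerm n p) := ⟨⟨fun _ => 0, 1⟩⟩

instance : Inv (ColPerm n p) :=
  ⟨fun x => ⟨fun i => -x.color (x.perm⁻¹ i), x.perm⁻¹⟩⟩

theorem mul_def (x y : ColPerm n p) :
    x * y = ⟨fun i => x.color (y.perm i) + y.color i, x.perm * y.perm⟩ := rfl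

theorem one_def : (1 : ColPerm n p) = ⟨fun _ => 0, 1⟩ := rfl

theorem inv_def (x : ColPerm n p) :
    x⁻¹ = ⟨fun i => -x.color (x.perm⁻¹ i), x.perm⁻¹⟩ := rfl

instance : Group (ColPerm n p) :=
  Group.ofLeftAxioms
    (by
      intro x y z
      simp only [mul_def, mk.injEq, mul_assoc, and_true, Equiv.Perm.mul_apply]
      funext i
      ring)
    (by
      intro x
      simp [mul_def, one_def])
    (by
      intro x
      simp [mul_def, one_def, inv_def])

/-- A colored permutation is a pair consisting of a coloring and a permutation. -/
def equivProd (n p : ℕ) : ColPerm n p ≃ (Fin n → ZMod p) × Equiv.Perm (Fin n) where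
  toFun x := (x.color, x.perm)
  invFun y := ⟨y.1, y.2⟩
  left_inv _ := rfl
  right_inv _ := rfl

instance [NeZero p] : Fintype (ColPerm n p) := Fintype.ofEquiv _ (equivProd n p).symm

end ColPerm

/-- The set `A_u` of colored permutations in which the largest `u` labels (those `i` with
`n - u ≤ i`, labels being counted from `0`) appear in increasing order and have color `0`. -/
def topSet (n p u : ℕ) : Set (ColPerm n p) :=
  {x | (∀ i j : Fin n, n - u ≤ (i : ℕ) → i < j → x.perm.symm i < x.perm.symm j) ∧
    ∀ i : Fin n, n - u ≤ (i : ℕ) → x.color (x.perm.symm i) = 0}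

/-- The one-step law `Q^{(m)}` of colored top-`m`-to-random (for `m ≤ n`): uniform on the set
`A_{n-m}`. -/
def topLaw (n p m : ℕ) [NeZero p] : ColPerm n p → ℝ := unifOn (topSet n p (n - m))

/-- The law `(Q^{(m)})^{*k}` of the deck after `k` steps. -/
def stepLaw (n p m k : ℕ) [NeZero p] : ColPerm n p → ℝ := convPow (topLaw n p m) k

/-- The time `k_n(c) = ⌊(n/m)(log n + c)⌋`. -/
def windowTime (m : ℕ) (c : ℝ) (n : ℕ) : ℕ := ⌊(n : ℝ) / m * (Real.log n + c)⌋₊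

/-! ### The limit profiles -/

/-- `λ = e^{-c}`. -/
def lam (c : ℝ) : ℝ := Real.exp (-c)

/-- `r = p λ`. -/
def rat (p : ℕ) (c : ℝ) : ℝ := p * lam c

/-- `s(ℓ) = e^{-λ} ∑_{u=0}^{ℓ} r^u`. -/
def sSum (p : ℕ) (c : ℝ) (l : ℕ) : ℝ :=
  Real.exp (-lam c) * ∑ u ∈ Finset.range (l + 1), rat p c ^ u

/-- `w* = min {ℓ ≥ 0 : s(ℓ) > 1}`; this set is never empty for `p ≥ 1`. -/
def wStar (p : ℕ) (c : ℝ) : ℕ := sInf {l | 1 < sSum p c l}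

/-- `a_ℓ = 1/(ℓ! p^ℓ) - 1/((ℓ+1)! p^{ℓ+1})`. -/
def aCoef (p l : ℕ) : ℝ :=
  1 / ((l.factorial : ℝ) * (p : ℝ) ^ l) - 1 / (((l + 1).factorial : ℝ) * (p : ℝ) ^ (l + 1))

/-- The total-variation profile `f_p(c)`. -/
def fProf (p : ℕ) (c : ℝ) : ℝ :=
  1 - Real.exp (-lam c) * ∑ u ∈ Finset.range (wStar p c), lam c ^ u / (u.factorial : ℝ)
    + (Real.exp (-lam c) * ∑ u ∈ Finset.range (wStar p c), rat p c ^ u - 1)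
      / (((wStar p c).factorial : ℝ) * (p : ℝ) ^ wStar p c)

/-- The separation profile `s_p(c)`. -/
def sepProf (p : ℕ) (c : ℝ) : ℝ :=
  if p = 1 then 1 - Real.exp (-lam c) * (1 + lam c) else 1 - Real.exp (-lam c)

/-- The terms of the series `H_{q,p}(c)`. -/
def hqTerm (q : ℝ) (p : ℕ) (c : ℝ) (l : ℕ) : ℝ := aCoef p l * |sSum p c l - 1| ^ q

/-- The `L^q` profile `H_{q,p}(c)`, `1 ≤ q < ∞`. -/
def hqProf (q : ℝ) (p : ℕ) (c : ℝ) : ℝ := ∑' l, hqTerm q p c l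

/-- The terms of the series `h_p(c)`. -/
def entTerm (p : ℕ) (c : ℝ) (l : ℕ) : ℝ := aCoef p l * (sSum p c l * Real.log (sSum p c l))

/-- The relative-entropy profile `h_p(c)`. -/
def entProf (p : ℕ) (c : ℝ) : ℝ := ∑' l, entTerm p c l

open Classical in
/-- The chi-squared profile `g_p(c)` in closed form. -/
def gProf (p : ℕ) (c : ℝ) : ℝ :=
  if rat p c = 1 then (2 * lam c + 1) * Real.exp (-lam c) - 1
  else (rat p c + 1) / (rat p c - 1) * Real.exp (-(lam c * (2 - rat p c)))
    - 2 / (rat p c - 1) * Real.exp (-lam c) - 1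

open Classical in
/-- The `L^∞` profile `H_{∞,p}(c)`, with values in the extended reals. -/
def hinfProf (p : ℕ) (c : ℝ) : EReal :=
  if rat p c < 1 then ((Real.exp (-lam c) / (1 - rat p c) - 1 : ℝ) : EReal) else ⊤

end

end ColoredShuffle

open ColoredShuffle

namespace ColoredShuffle

noncomputable section

/-! ### Moving one card to the top -/

/-! Write `A_u` for `topSet n p u` and `U_u` for the uniform law on it. One top-to-random move,
summed over all positions and colors, sends `U_u` to a combination of `U_u` and `U_(u-1)` only
(`topOp_topUnif`). Since `U_n` is the point mass at the identity and the `m`-card step law is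
`U_(n-m)`, every such law can be built by repeated one-card moves. Hence after `k` steps the deck is
a mixture of the `U_u`, and the mixing weight at `u` is the law of the number of labels never drawn
in `k` rounds of `m` draws without replacement (`stepLaw_eq_mix`): a coupon-collector problem.

The binomial moments of that number are explicit products (`sum_choose_mul_undrawn`). At the window
time they tend to `λ^v / v!`, with bounds strong enough to invert them under the sum, so the number
is asymptotically Poisson with mean `λ` (`tendsto_windowLaw`).

The sets `A_u` are nested and `U_u` has density `u! p^u` on `A_u`. The density of a mixture at `x`
therefore depends only on the largest `u` with `x ∈ A_u`, the level of `x`, and is increasing in it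
(`mix_div_unif`). Under the uniform law the level is `l` with probability `aCoef p l` once `n > l`,
and the density there tends to `sSum p c l`. Every integral distance is an average over the level,
and passes to the limit by dominated convergence because factorial weights beat exponentially
growing densities. Separation and the `L^∞` norm are read off at the extreme levels. The closed
forms come from summation by parts (`hasSum_aCoef_mul`), and the monotone profile required for a
cutoff is `fProf`. -/

theorem cycleRange_lt_cycleRange_iff {n : ℕ} (i a b : Fin n) :
    Fin.cycleRange i a < Fin.cycleRange i b ↔ b ≠ i ∧ (a = i ∨ a < b) := by
  have key : ∀ x : Fin n, (Fin.cycleRange i x : ℕ) =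
      if (x : ℕ) < i then (x : ℕ) + 1 else if (x : ℕ) = i then 0 else x := by
    intro x
    rcases lt_trichotomy x i with h | h | h
    · rw [Fin.coe_cycleRange_of_lt h, if_pos (Fin.lt_def.1 h)]
    · subst h; rw [Fin.coe_cycleRange_of_le le_rfl]; simp
    · have h' := Fin.lt_def.1 h
      rw [Fin.cycleRange_of_gt h, if_neg (by omega), if_neg (by omega)]
  rw [Fin.lt_def, key, key, Ne, Fin.ext_iff, Fin.ext_iff, Fin.lt_def]
  split_ifs <;> omega

section Group

variable {X : Type*} [Fintype X] [Group X]

theorem sum_convol (M N : X → ℝ) : ∑ z, convol M N z = (∑ x, M x) * ∑ x, N x := by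
  simp only [convol]
  rw [Finset.sum_comm, Finset.mul_sum]
  refine Finset.sum_congr rfl fun u _ => ?_
  rw [← Finset.sum_mul]
  congr 1
  exact Fintype.sum_equiv (Equiv.mulRight u⁻¹) _ _ fun x => rfl

open Classical in
theorem convol_dirac (M : X → ℝ) : convol M (fun z => if z = 1 then 1 else 0) = M := by
  funext z
  simp [convol]

end Group

variable {n p : ℕ}

/-- The deck obtained from the sorted one by moving the top card to position `i` and giving it
color `c`. -/
def topMove (i : Fin n) (c : ZMod p) : ColPerm n p := ⟨Pi.single i c, Fin.cycleRange i⟩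

/-- Right convolution with the counting measure of the moves `topMove i c`. -/
def topOp [NeZero p] (M : ColPerm n p → ℝ) : ColPerm n p → ℝ :=
  fun z => ∑ i, ∑ c : ZMod p, M (z * (topMove i c)⁻¹)

theorem perm_symm_mul_topMove_inv (z : ColPerm n p) (i l : Fin n) (c : ZMod p) :
    (z * (topMove i c)⁻¹).perm.symm l = Fin.cycleRange i (z.perm.symm l) := by
  rw [Equiv.symm_apply_eq]
  simp [ColPerm.mul_def, ColPerm.inv_def, topMove, Equiv.Perm.mul_apply]

theorem color_mul_topMove_inv (z : ColPerm n p) (i a : Fin n) (c : ZMod p) :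
    (z * (topMove i c)⁻¹).color (Fin.cycleRange i a) = z.color a - if a = i then c else 0 := by
  simp [ColPerm.mul_def, ColPerm.inv_def, topMove, Pi.single_apply, sub_eq_add_neg]

theorem mem_topSet {u : ℕ} {x : ColPerm n p} : x ∈ topSet n p u ↔
    (∀ i j : Fin n, n - u ≤ (i : ℕ) → i < j → x.perm.symm i < x.perm.symm j) ∧
    ∀ i : Fin n, n - u ≤ (i : ℕ) → x.color (x.perm.symm i) = 0 := Iff.rfl

theorem mul_topMove_inv_mem_iff (z : ColPerm n p) (i : Fin n) (c : ZMod p) (u : ℕ) :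
    z * (topMove i c)⁻¹ ∈ topSet n p u ↔
    (∀ a b : Fin n, n - u ≤ (a : ℕ) → a < b →
      b ≠ z.perm i ∧ (a = z.perm i ∨ z.perm.symm a < z.perm.symm b)) ∧
    ∀ a : Fin n, n - u ≤ (a : ℕ) →
      z.color (z.perm.symm a) = if a = z.perm i then c else 0 := by
  simp only [mem_topSet, perm_symm_mul_topMove_inv, color_mul_topMove_inv,
    cycleRange_lt_cycleRange_iff, sub_eq_zero, Ne, Equiv.symm_apply_eq]

/-- Undoing the move lifts the card at position `i` to the top and subtracts `c` from its color. If
its label is not among the largest `u`, neither the relative order nor the colors of those labels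
change. The next two lemmas treat the other possible labels. -/
theorem mul_topMove_inv_mem_of_lt (z : ColPerm n p) (i : Fin n) (c : ZMod p) (u : ℕ)
    (h : (z.perm i : ℕ) < n - u) :
    z * (topMove i c)⁻¹ ∈ topSet n p u ↔ z ∈ topSet n p u := by
  rw [mul_topMove_inv_mem_iff, mem_topSet]
  have hne : ∀ a : Fin n, n - u ≤ (a : ℕ) → a ≠ z.perm i := by
    intro a ha hh; rw [hh] at ha; omega
  constructor
  · rintro ⟨h1, h2⟩
    refine ⟨fun a b ha hab => ?_, fun a ha => ?_⟩
    · exact ((h1 a b ha hab).2).resolve_left (hne a ha)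
    · rw [h2 a ha, if_neg (hne a ha)]
  · rintro ⟨h1, h2⟩
    refine ⟨fun a b ha hab => ⟨hne b (ha.trans (Fin.lt_def.1 hab).le), Or.inr (h1 a b ha hab)⟩,
      fun a ha => ?_⟩
    rw [h2 a ha, if_neg (hne a ha)]

theorem mul_topMove_inv_mem_of_eq (z : ColPerm n p) (i : Fin n) (c : ZMod p) (u : ℕ)
    (hu : u + 1 ≤ n) (h : (z.perm i : ℕ) = n - (u + 1)) :
    z * (topMove i c)⁻¹ ∈ topSet n p (u + 1) ↔ z ∈ topSet n p u ∧ c = z.color i := by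
  rw [mul_topMove_inv_mem_iff, mem_topSet]
  constructor
  · rintro ⟨h1, h2⟩
    refine ⟨⟨fun a b ha hab => ?_, fun a ha => ?_⟩, ?_⟩
    · refine ((h1 a b (by omega) hab).2).resolve_left fun hh => ?_
      rw [hh] at ha; omega
    · rw [h2 a (by omega), if_neg]
      intro hh; rw [hh] at ha; omega
    · have := h2 (z.perm i) h.ge
      simpa using this.symm
  · rintro ⟨⟨h1, h2⟩, h3⟩
    refine ⟨fun a b ha hab => ⟨?_, ?_⟩, fun a ha => ?_⟩
    · intro hh; rw [hh, Fin.lt_def] at hab; omega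
    · by_cases hh : a = z.perm i
      · exact Or.inl hh
      · refine Or.inr (h1 a b ?_ hab)
        have : (a : ℕ) ≠ z.perm i := fun h' => hh (Fin.ext h')
        omega
    · split_ifs with hh
      · rw [hh, h3]; simp
      · refine h2 a ?_
        have : (a : ℕ) ≠ z.perm i := fun h' => hh (Fin.ext h')
        omega

/-- The lifted card now lies above the card labelled `n - u`, which ought to precede it. -/
theorem mul_topMove_inv_notMem_of_gt (z : ColPerm n p) (i : Fin n) (c : ZMod p) (u : ℕ)
    (h : n - u < (z.perm i : ℕ)) : z * (topMove i c)⁻¹ ∉ topSet n p u := by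
  rw [mul_topMove_inv_mem_iff]
  rintro ⟨h1, -⟩
  exact (h1 ⟨n - u, h.trans (z.perm i).2⟩ (z.perm i) le_rfl (Fin.lt_def.2 h)).1 rfl

/-- The indicator function of `topSet n p u`. -/
def topInd (n p u : ℕ) : ColPerm n p → ℝ := (topSet n p u).indicator 1

open Classical in
theorem topInd_apply (u : ℕ) (z : ColPerm n p) :
    topInd n p u z = if z ∈ topSet n p u then 1 else 0 := by
  simp [topInd, Set.indicator_apply]

theorem topSet_zero : topSet n p 0 = Set.univ := by
  ext x
  simp only [mem_topSet, Set.mem_univ, iff_true]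
  exact ⟨fun i j h => absurd i.2 (by omega), fun i h => absurd i.2 (by omega)⟩

theorem one_mem_topSet (u : ℕ) : (1 : ColPerm n p) ∈ topSet n p u := by
  refine ⟨fun i j _ hij => ?_, fun i _ => rfl⟩
  exact hij

theorem topSet_anti : Antitone (topSet n p) := by
  intro u v huv x hx
  exact ⟨fun i j hi hij => hx.1 i j (by omega) hij, fun i hi => hx.2 i (by omega)⟩

theorem topSet_self : topSet n p n = {1} := by
  ext x
  simp only [Set.mem_singleton_iff]
  refine ⟨fun hx => ?_, fun hx => hx ▸ one_mem_topSet n⟩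
  have h1 : StrictMono x.perm.symm := fun i j hij => hx.1 i j (by simp) hij
  have h2 : (x.perm.symm : Fin n → Fin n) = id :=
    (h1.range_inj strictMono_id).1 (by simp [x.perm.symm.surjective.range_eq])
  have h3 : x.perm = 1 := by
    ext i
    have := congrFun h2 (x.perm i)
    simp only [Equiv.symm_apply_apply, id] at this
    simp [← this]
  ext i
  · have := hx.2 i (by simp)
    rw [h3] at this
    exact this
  · rw [h3]; rfl

variable [NeZero p]

/-- Summing over positions is summing over the label of the lifted card. Each label below `n - (u +
1)` contributes once for every color; the label `n - (u + 1)` is allowed anywhere in `z` but fixes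
one color, which gives membership in `topSet n p u`; larger labels contribute nothing. -/
theorem topOp_topInd_succ (u : ℕ) (hu : u + 1 ≤ n) (z : ColPerm n p) :
    topOp (topInd n p (u + 1)) z =
      ((n : ℝ) - (u + 1)) * p * topInd n p (u + 1) z + topInd n p u z := by
  classical
  let F : Fin n → ℝ := fun l => (if (l : ℕ) < n - (u + 1) then p * topInd n p (u + 1) z else 0) +
    if l = (⟨n - (u + 1), by omega⟩ : Fin n) then topInd n p u z else 0
  have key : ∀ i : Fin n, ∑ c : ZMod p, topInd n p (u + 1) (z * (topMove i c)⁻¹) =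
      F (z.perm i) := by
    intro i
    simp only [F]
    rcases lt_trichotomy (z.perm i : ℕ) (n - (u + 1)) with h | h | h
    · simp only [topInd_apply, mul_topMove_inv_mem_of_lt z i _ _ h, Fin.ext_iff, h, h.ne,
        if_true, if_false, Finset.sum_const, Finset.card_univ, ZMod.card, nsmul_eq_mul, add_zero]
    · simp only [topInd_apply, mul_topMove_inv_mem_of_eq z i _ _ hu h, Fin.ext_iff, h,
        if_true, lt_irrefl, if_false, zero_add]
      by_cases hz : z ∈ topSet n p u <;> simp [hz]
    · simp only [topInd_apply, mul_topMove_inv_notMem_of_gt z i _ _ h, Fin.ext_iff, h.ne', h.not_gt,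
        if_false, Finset.sum_const_zero, add_zero]
  rw [topOp, Finset.sum_congr rfl fun i _ => key i, Equiv.sum_comp z.perm F, Finset.sum_add_distrib,
    Finset.sum_ite_eq', if_pos (Finset.mem_univ _), ← Finset.sum_filter, Finset.sum_const]
  have : (Finset.univ.filter fun l : Fin n => (l : ℕ) < n - (u + 1)).card = n - (u + 1) := by
    rw [Fin.card_filter_val_lt]; omega
  rw [this, nsmul_eq_mul, Nat.cast_sub hu]
  push_cast
  ring

theorem topOp_topInd_zero (z : ColPerm n p) :
    topOp (topInd n p 0) z = (n : ℝ) * p * topInd n p 0 z := by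
  simp [topOp, topInd, topSet_zero, ZMod.card]

theorem topOp_sum {ι : Type*} (s : Finset ι) (c : ι → ℝ) (M : ι → ColPerm n p → ℝ)
    (z : ColPerm n p) :
    topOp (fun x => ∑ k ∈ s, c k * M k x) z = ∑ k ∈ s, c k * topOp (M k) z := by
  simp only [topOp, Finset.mul_sum]
  rw [Finset.sum_comm (s := s)]
  refine Finset.sum_congr rfl fun i _ => ?_
  rw [Finset.sum_comm]

theorem sum_topOp (M : ColPerm n p → ℝ) : ∑ z, topOp M z = n * p * ∑ z, M z := by
  simp only [topOp]
  rw [Finset.sum_comm]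
  have : ∀ i : Fin n, ∑ z : ColPerm n p, ∑ c : ZMod p, M (z * (topMove i c)⁻¹)
      = p * ∑ z, M z := by
    intro i
    rw [Finset.sum_comm]
    have h : ∀ c : ZMod p, ∑ z : ColPerm n p, M (z * (topMove i c)⁻¹) = ∑ z, M z := fun c =>
      Equiv.sum_comp (Equiv.mulRight (topMove i c)⁻¹) M
    simp [h, ZMod.card]
  simp [this, mul_assoc]

theorem convol_topOp (M N : ColPerm n p → ℝ) (z : ColPerm n p) :
    convol M (topOp N) z = topOp (convol M N) z := by
  simp only [convol, topOp, Finset.mul_sum]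
  rw [Finset.sum_comm]
  refine Finset.sum_congr rfl fun i _ => ?_
  rw [Finset.sum_comm]
  refine Finset.sum_congr rfl fun c _ => ?_
  refine Fintype.sum_equiv (Equiv.mulRight (topMove i c)⁻¹) _ _ fun u => ?_
  simp [mul_assoc]

end

end ColoredShuffle

namespace ColoredShuffle

noncomputable section

/-! ### The law of the deck as a mixture of the uniform laws on the sets `topSet` -/

variable {n p : ℕ}

/-- The uniform law on `topSet n p u`. -/
def topUnif (n p u : ℕ) : ColPerm n p → ℝ := unifOn (topSet n p u)

theorem topUnif_eq (u : ℕ) (z : ColPerm n p) :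
    topUnif n p u z = topInd n p u z / (topSet n p u).ncard := by
  classical
  simp only [topUnif, unifOn, topInd_apply, Set.indicator_apply]
  split_ifs <;> simp

open Classical in
theorem topUnif_self : topUnif n p n = fun z => if z = 1 then 1 else 0 := by
  funext z
  simp [topUnif_eq, topInd_apply, topSet_self]

variable [NeZero p]

theorem topSet_ncard_pos (u : ℕ) : 0 < (topSet n p u).ncard :=
  (Set.ncard_pos (Set.toFinite _)).2 ⟨1, one_mem_topSet u⟩

theorem sum_topInd (u : ℕ) : ∑ z, topInd n p u z = (topSet n p u).ncard := by
  classical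
  simp only [topInd_apply, Finset.sum_boole]
  rw [Set.ncard_eq_toFinset_card']
  congr 2
  ext; simp

/-- Obtained without a bijection, by summing `topOp_topInd_succ` over the group and comparing total
masses. -/
theorem topSet_ncard_succ (u : ℕ) (hu : u + 1 ≤ n) :
    ((topSet n p u).ncard : ℝ) = (u + 1) * p * (topSet n p (u + 1)).ncard := by
  have h := sum_topOp (topInd n p (u + 1))
  simp only [topOp_topInd_succ u hu, Finset.sum_add_distrib, ← Finset.mul_sum, sum_topInd] at h
  linarith

theorem sum_topUnif (u : ℕ) : ∑ z, topUnif n p u z = 1 := by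
  simp only [topUnif_eq, ← Finset.sum_div, sum_topInd]
  exact div_self (Nat.cast_pos.2 (topSet_ncard_pos u)).ne'

theorem topOp_topUnif (u : ℕ) (hu : u ≤ n) (z : ColPerm n p) :
    topOp (topUnif n p u) z =
      p * (((n : ℝ) - u) * topUnif n p u z + u * topUnif n p (u - 1) z) := by
  have h0 : topOp (topUnif n p u) z = topOp (topInd n p u) z / (topSet n p u).ncard := by
    simp only [topOp, topUnif_eq, Finset.sum_div]
  rw [h0]
  rcases u with _ | u
  · rw [topOp_topInd_zero, topUnif_eq]
    push_cast; ring
  · have hpos : (0 : ℝ) < (topSet n p (u + 1)).ncard := Nat.cast_pos.2 (topSet_ncard_pos _)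
    have hp : (p : ℝ) ≠ 0 := NeZero.ne _
    have hu' : (u : ℝ) + 1 ≠ 0 := by positivity
    rw [topOp_topInd_succ u hu, topUnif_eq, topUnif_eq, Nat.add_sub_cancel,
      topSet_ncard_succ u hu]
    push_cast
    field_simp

/-- This is `topOp_topUnif` at `u = n - j`, solved for the term of lower index. It builds the step
law with `j + 1` cards from the one with `j` cards by a single one-card move. -/
theorem convol_topUnif_pred (M : ColPerm n p → ℝ) (j : ℕ) (hj : j < n) (z : ColPerm n p) :
    convol M (topUnif n p (n - (j + 1))) z =
      (topOp (convol M (topUnif n p (n - j))) z / p - j * convol M (topUnif n p (n - j)) z)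
        / (n - j) := by
  have hp : (p : ℝ) ≠ 0 := NeZero.ne _
  have hjn : (n : ℝ) - j ≠ 0 := by
    have : (j : ℝ) < n := by exact_mod_cast hj
    linarith
  rw [← convol_topOp]
  simp only [convol, Finset.mul_sum, Finset.sum_div, ← Finset.sum_sub_distrib]
  refine Finset.sum_congr rfl fun x _ => ?_
  rw [topOp_topUnif _ (Nat.sub_le _ _), Nat.sub_sub, Nat.cast_sub hj.le]
  field_simp
  ring

/-- The effect on the law `P` of the number of labels never drawn of one further draw, uniform
among the `n - j` labels not yet drawn in the current round. -/
def draw (n j : ℕ) (P : ℕ → ℝ) : ℕ → ℝ :=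
  fun u => ((u + 1) * P (u + 1) + ((n : ℝ) - u - j) * P u) / (n - j)

/-- The effect of a round of `m` draws without replacement. -/
def draws (n : ℕ) : ℕ → (ℕ → ℝ) → ℕ → ℝ
  | 0, P => P
  | m + 1, P => draw n m (draws n m P)

/-- The law of the number of labels, among `n`, never drawn in `k` rounds of `m` draws. -/
def undrawn (n m : ℕ) : ℕ → ℕ → ℝ
  | 0 => fun u => if u = n then 1 else 0
  | k + 1 => draws n m (undrawn n m k)

/-- The mixture of the uniform laws on the sets `topSet n p u` with weights `P u`. -/
def mix (n p : ℕ) (P : ℕ → ℝ) : ColPerm n p → ℝ :=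
  fun z => ∑ u ∈ Finset.range (n + 1), P u * topUnif n p u z

theorem topOp_mix (P : ℕ → ℝ) (hP : P (n + 1) = 0) (z : ColPerm n p) :
    topOp (mix n p P) z =
      p * mix n p (fun u => (u + 1) * P (u + 1) + ((n : ℝ) - u) * P u) z := by
  unfold mix
  rw [topOp_sum]
  have h1 : ∀ u ∈ Finset.range (n + 1), P u * topOp (topUnif n p u) z =
      p * (((n : ℝ) - u) * P u * topUnif n p u z) + p * (u * P u * topUnif n p (u - 1) z) := by
    intro u hu
    rw [topOp_topUnif u (by simpa [Nat.lt_succ_iff] using hu)]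
    ring
  rw [Finset.sum_congr rfl h1, Finset.sum_add_distrib, ← Finset.mul_sum, ← Finset.mul_sum,
    ← mul_add]
  congr 1
  rw [Finset.sum_range_succ' (fun u : ℕ => (u : ℝ) * P u * topUnif n p (u - 1) z)]
  simp only [add_mul, Finset.sum_add_distrib, Nat.add_sub_cancel]
  rw [Finset.sum_range_succ (fun u : ℕ => (u : ℝ) * P (u + 1) * topUnif n p u z),
    Finset.sum_range_succ (fun u : ℕ => 1 * P (u + 1) * topUnif n p u z), hP]
  push_cast
  simp only [add_mul, Finset.sum_add_distrib]
  ring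

theorem draw_support {j : ℕ} {P : ℕ → ℝ} (hP : ∀ u, n - j < u → P u = 0) :
    ∀ u, n - (j + 1) < u → draw n j P u = 0 := by
  intro u hu
  rw [draw, hP (u + 1) (by omega)]
  rcases lt_or_ge (n - j) u with h | h
  · rw [hP u h]; simp
  · rcases le_or_gt n j with h' | h'
    · omega
    · have : u = n - j := by omega
      subst this
      rw [Nat.cast_sub h'.le]; simp

theorem draws_support {P : ℕ → ℝ} (hP : ∀ u, n < u → P u = 0) (m : ℕ) :
    ∀ u, n - m < u → draws n m P u = 0 := by
  induction m with
  | zero => simpa [draws] using hP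
  | succ m ih => exact draw_support ih

theorem draw_nonneg {j : ℕ} (hj : j < n) {P : ℕ → ℝ} (hP : ∀ u, n - j < u → P u = 0)
    (h0 : ∀ u, 0 ≤ P u) (u : ℕ) : 0 ≤ draw n j P u := by
  have hjn : (j : ℝ) < n := by exact_mod_cast hj
  refine div_nonneg (add_nonneg (mul_nonneg (by positivity) (h0 _)) ?_) (by linarith)
  rcases lt_or_ge (n - j) u with h | h
  · rw [hP u h]; simp
  · refine mul_nonneg ?_ (h0 u)
    have : ((u + j : ℕ) : ℝ) ≤ n := by exact_mod_cast (by omega : u + j ≤ n)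
    push_cast at this
    linarith

theorem draws_nonneg {m : ℕ} (hm : m ≤ n) {P : ℕ → ℝ} (hP : ∀ u, n < u → P u = 0)
    (h0 : ∀ u, 0 ≤ P u) (u : ℕ) : 0 ≤ draws n m P u := by
  induction m generalizing u with
  | zero => exact h0 u
  | succ m ih => exact draw_nonneg hm (draws_support hP m) (ih (by omega)) u

/-- Induction on the number of cards, starting from the point mass: `convol_topUnif_pred` and
`topOp_mix` turn each additional card into one `draw` acting on the weights. -/
theorem convol_mix_topUnif (P : ℕ → ℝ) (hP : ∀ u, n < u → P u = 0) (m : ℕ) (hm : m ≤ n) :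
    convol (mix n p P) (topUnif n p (n - m)) = mix n p (draws n m P) := by
  induction m with
  | zero => rw [Nat.sub_zero, topUnif_self, convol_dirac]; rfl
  | succ m ih =>
    funext z
    have hp : (p : ℝ) ≠ 0 := NeZero.ne _
    have hjn : (n : ℝ) - m ≠ 0 := by
      have : (m : ℝ) < n := by exact_mod_cast hm
      linarith
    rw [convol_topUnif_pred _ _ hm, ih (by omega),
      topOp_mix _ (draws_support hP m _ (by omega)), mul_div_cancel_left₀ _ hp]
    simp only [mix, Finset.mul_sum, ← Finset.sum_sub_distrib, Finset.sum_div, draws, draw]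
    refine Finset.sum_congr rfl fun u _ => ?_
    field_simp
    ring

theorem undrawn_support (m k : ℕ) : ∀ u, n < u → undrawn n m k u = 0 := by
  induction k with
  | zero => intro u hu; simp [undrawn, hu.ne']
  | succ k ih => exact fun u hu => draws_support ih m u (by omega)

theorem undrawn_nonneg {m : ℕ} (hm : m ≤ n) (k u : ℕ) : 0 ≤ undrawn n m k u := by
  induction k generalizing u with
  | zero => simp only [undrawn]; split_ifs <;> norm_num
  | succ k ih => exact draws_nonneg hm (undrawn_support m k) ih u

theorem stepLaw_eq_mix {m : ℕ} (hm : m ≤ n) (k : ℕ) :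
    stepLaw n p m k = mix n p (undrawn n m k) := by
  induction k with
  | zero =>
    funext z
    have := congrFun (topUnif_self (n := n) (p := p)) z
    simp [stepLaw, convPow, mix, undrawn, this]
  | succ k ih =>
    rw [undrawn, ← convol_mix_topUnif _ (undrawn_support m k) m hm, ← ih]
    rfl

/-! ### Factorial moments -/

/-- The binomial moment counts `v`-sets of undrawn labels, and a given `v`-set survives a uniform
draw among `n - j` labels with probability `(n - j - v) / (n - j)`. The algebra behind it is `(u + 1
- v) * choose (u + 1) v = (u + 1) * choose u v`. -/
theorem sum_choose_mul_draw {j : ℕ} (hj : j < n) (v : ℕ) {P : ℕ → ℝ} (hP : P (n + 1) = 0) :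
    ∑ u ∈ Finset.range (n + 1), (u.choose v : ℝ) * draw n j P u =
      ((n : ℝ) - j - v) / (n - j) * ∑ u ∈ Finset.range (n + 1), (u.choose v : ℝ) * P u := by
  have hjn : (n : ℝ) - j ≠ 0 := by
    have : (j : ℝ) < n := by exact_mod_cast hj
    linarith
  have h1 : ∑ u ∈ Finset.range (n + 1), (u.choose v : ℝ) * ((u + 1) * P (u + 1)) =
      ∑ u ∈ Finset.range (n + 1), ((u : ℝ) - v) * u.choose v * P u := by
    rw [Finset.sum_range_succ, hP, Finset.sum_range_succ' _ n]
    have h0 : ((0 : ℕ) - v : ℝ) * (Nat.choose 0 v) * P 0 = 0 := by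
      rcases v with _ | v <;> simp
    rw [h0]
    simp only [mul_zero, add_zero]
    refine Finset.sum_congr rfl fun u _ => ?_
    have h2 : ((u + 1 : ℕ) - v : ℝ) * (u + 1).choose v = (u + 1) * u.choose v := by
      rcases le_or_gt v (u + 1) with h | h
      · have h4 : (u + 1).choose v * (u + 1 - v) = (u + 1) * u.choose v := by
          have := Nat.choose_mul_succ_eq u v
          rw [mul_comm (u + 1), this]
        have h5 : (((u + 1 - v : ℕ)) : ℝ) = ((u + 1 : ℕ) : ℝ) - v := Nat.cast_sub h
        rw [← h5, mul_comm]
        exact_mod_cast h4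
      · rw [Nat.choose_eq_zero_of_lt h, Nat.choose_eq_zero_of_lt (by omega)]; simp
    rw [h2]; ring
  have h2 : ∀ u : ℕ, (u.choose v : ℝ) * draw n j P u =
      ((u.choose v : ℝ) * ((u + 1) * P (u + 1)) +
        u.choose v * (((n : ℝ) - u - j) * P u)) / (n - j) := by
    intro u; rw [draw]; ring
  rw [Finset.sum_congr rfl fun u _ => h2 u, ← Finset.sum_div, Finset.sum_add_distrib, h1,
    ← Finset.sum_add_distrib, Finset.sum_div, Finset.mul_sum]
  refine Finset.sum_congr rfl fun u _ => ?_
  field_simp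
  ring

theorem sum_choose_mul_draws {m : ℕ} (hm : m ≤ n) (v : ℕ) {P : ℕ → ℝ}
    (hP : ∀ u, n < u → P u = 0) :
    ∑ u ∈ Finset.range (n + 1), (u.choose v : ℝ) * draws n m P u =
      (∏ j ∈ Finset.range m, ((n : ℝ) - j - v) / (n - j)) *
        ∑ u ∈ Finset.range (n + 1), (u.choose v : ℝ) * P u := by
  induction m with
  | zero => simp [draws]
  | succ m ih =>
    rw [draws, sum_choose_mul_draw hm v (draws_support hP m _ (by omega)), ih (by omega),
      Finset.prod_range_succ]
    ring

theorem sum_choose_mul_undrawn {m : ℕ} (hm : m ≤ n) (v k : ℕ) :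
    ∑ u ∈ Finset.range (n + 1), (u.choose v : ℝ) * undrawn n m k u =
      n.choose v * (∏ j ∈ Finset.range m, ((n : ℝ) - j - v) / (n - j)) ^ k := by
  induction k with
  | zero => simp [undrawn]
  | succ k ih =>
    rw [undrawn, sum_choose_mul_draws hm v (undrawn_support m k), ih, pow_succ]
    ring

end

end ColoredShuffle

namespace ColoredShuffle

noncomputable section

/-! ### The density with respect to the uniform law -/

variable {n p : ℕ}

/-- The value on `topSet n p l \ topSet n p (l + 1)` of the density of `mix n p P` with respect to
the uniform law. -/
def dens (p : ℕ) (P : ℕ → ℝ) (l : ℕ) : ℝ :=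
  ∑ u ∈ Finset.range (l + 1), P u * (u.factorial * (p : ℝ) ^ u)

open Classical in
/-- The largest `u ≤ n` such that `x` belongs to `topSet n p u`. -/
def level (x : ColPerm n p) : ℕ := Nat.findGreatest (fun u => x ∈ topSet n p u) n

theorem level_le (x : ColPerm n p) : level x ≤ n := by
  classical exact Nat.findGreatest_le n

theorem mem_topSet_iff_le_level {u : ℕ} (hu : u ≤ n) (x : ColPerm n p) :
    x ∈ topSet n p u ↔ u ≤ level x := by
  classical
  refine ⟨fun h => Nat.le_findGreatest hu h, fun h => topSet_anti h ?_⟩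
  exact Nat.findGreatest_spec (P := fun u => x ∈ topSet n p u) (Nat.zero_le n)
    (by rw [topSet_zero]; trivial)

theorem level_one : level (1 : ColPerm n p) = n :=
  le_antisymm (level_le _) ((mem_topSet_iff_le_level le_rfl _).1 (one_mem_topSet n))

theorem dens_mono {P : ℕ → ℝ} (hP : ∀ u, 0 ≤ P u) : Monotone (dens p P) := by
  intro a b hab
  refine Finset.sum_le_sum_of_subset_of_nonneg (Finset.range_mono (by omega)) fun u _ _ => ?_
  have := hP u
  positivity

variable [NeZero p]

theorem card_colPerm (u : ℕ) (hu : u ≤ n) :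
    (Fintype.card (ColPerm n p) : ℝ) = u.factorial * (p : ℝ) ^ u * (topSet n p u).ncard := by
  induction u with
  | zero => simp [topSet_zero, Set.ncard_univ, Nat.card_eq_fintype_card]
  | succ u ih =>
    rw [ih (by omega), topSet_ncard_succ u hu, Nat.factorial_succ]
    push_cast; ring

/-- Only the components with `u ≤ level x` charge `x`, and by `card_colPerm` each has relative
density `u! p^u` there. -/
theorem mix_div_unif (P : ℕ → ℝ) (x : ColPerm n p) :
    mix n p P x / unif (ColPerm n p) x = dens p P (level x) := by
  classical
  have h1 : ∀ u ∈ Finset.range (n + 1), P u * topUnif n p u x * Fintype.card (ColPerm n p) =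
      if u ∈ Finset.range (level x + 1) then P u * (u.factorial * (p : ℝ) ^ u) else 0 := by
    intro u hu
    have hu' : u ≤ n := by simpa [Nat.lt_succ_iff] using hu
    have hpos : (0 : ℝ) < (topSet n p u).ncard := Nat.cast_pos.2 (topSet_ncard_pos _)
    rw [card_colPerm u hu', topUnif_eq, topInd_apply, mem_topSet_iff_le_level hu' x,
      if_congr (Finset.mem_range.trans Nat.lt_succ_iff) rfl rfl]
    split_ifs
    · field_simp
    · simp
  have h2 := level_le x
  rw [unif, div_div_eq_mul_div, div_one, mix, Finset.sum_mul, Finset.sum_congr rfl h1,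
    ← Finset.sum_filter, dens]
  congr 1
  ext u
  simp only [Finset.mem_filter, Finset.mem_range]
  omega

/-- The probability under the uniform law that the level is `l`. -/
def levelWt (n p l : ℕ) : ℝ :=
  if l < n then aCoef p l else if l = n then 1 / ((n.factorial : ℝ) * (p : ℝ) ^ n) else 0

/-- The level is at least `u` with probability `1 / (u! p^u)`, so the weights are differences of
consecutive tails, except at the top level `n`. The finite sum is written as a series so that
different `n` can be compared under one dominating series. -/
theorem sum_unif_mul_level (φ : ℕ → ℝ) :
    ∑ x : ColPerm n p, φ (level x) * unif (ColPerm n p) x = ∑' l, levelWt n p l * φ l := by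
  classical
  have h1 : ∀ x : ColPerm n p, φ (level x) = ∑ l ∈ Finset.range n,
      (topInd n p l x - topInd n p (l + 1) x) * φ l + topInd n p n x * φ n := by
    intro x
    have hl := level_le x
    have h2 : ∀ l ∈ Finset.range n, (topInd n p l x - topInd n p (l + 1) x) * φ l =
        if l = level x then φ l else 0 := by
      intro l hl
      have hl' : l < n := by simpa using hl
      rw [topInd_apply, topInd_apply, mem_topSet_iff_le_level hl'.le,
        mem_topSet_iff_le_level (u := l + 1) hl']
      rcases lt_trichotomy l (level x) with h | h | h
      · rw [if_pos h.le, if_pos (Nat.succ_le_of_lt h), if_neg h.ne]; simp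
      · rw [if_pos h.le, if_neg (by omega), if_pos h]; simp
      · rw [if_neg (by omega), if_neg (by omega), if_neg h.ne']; simp
    rw [Finset.sum_congr rfl h2, Finset.sum_ite_eq', topInd_apply, mem_topSet_iff_le_level le_rfl,
      if_congr Finset.mem_range rfl rfl]
    rcases hl.lt_or_eq with h | h
    · rw [if_pos h, if_neg (by omega)]; simp
    · rw [if_neg (by omega), if_pos (by omega), h]; simp
  have h3 : ∀ u, u ≤ n → (∑ x, topInd n p u x) * (1 / (Fintype.card (ColPerm n p) : ℝ)) =
      1 / (u.factorial * (p : ℝ) ^ u) := by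
    intro u hu
    have hpos : (0 : ℝ) < (topSet n p u).ncard := Nat.cast_pos.2 (topSet_ncard_pos _)
    have hp : (p : ℝ) ≠ 0 := NeZero.ne _
    rw [sum_topInd, card_colPerm u hu]
    field_simp
  have h4 : ∑' l, levelWt n p l * φ l = ∑ l ∈ Finset.range n, aCoef p l * φ l +
      1 / ((n.factorial : ℝ) * (p : ℝ) ^ n) * φ n := by
    rw [tsum_eq_sum (s := Finset.range (n + 1)), Finset.sum_range_succ]
    · congr 1
      · refine Finset.sum_congr rfl fun l hl => ?_
        rw [levelWt, if_pos (by simpa using hl)]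
      · simp [levelWt]
    · intro l hl
      rw [levelWt, if_neg (by simp at hl; omega), if_neg (by simp at hl; omega), zero_mul]
  rw [h4, ← h3 n le_rfl]
  simp only [h1, unif, add_mul, Finset.sum_add_distrib, Finset.sum_mul]
  rw [Finset.sum_comm]
  congr 1
  · refine Finset.sum_congr rfl fun l hl => ?_
    have hl' : l < n := by simpa using hl
    rw [aCoef, ← h3 l hl'.le, ← h3 (l + 1) hl', ← sub_mul, ← Finset.sum_sub_distrib,
      Finset.sum_mul, Finset.sum_mul]
    exact Finset.sum_congr rfl fun x _ => by ring
  · exact Finset.sum_congr rfl fun x _ => by ring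

theorem aCoef_eq (l : ℕ) : aCoef p l =
    ((l + 1) * p - 1) / ((l + 1).factorial * (p : ℝ) ^ (l + 1)) := by
  have hp : (p : ℝ) ≠ 0 := NeZero.ne _
  rw [aCoef, Nat.factorial_succ]
  push_cast
  field_simp
  ring

theorem one_le_cast (p : ℕ) [NeZero p] : (1 : ℝ) ≤ p := by
  exact_mod_cast NeZero.one_le

theorem aCoef_nonneg (l : ℕ) : 0 ≤ aCoef p l := by
  have hp := one_le_cast p
  rw [aCoef_eq]
  refine div_nonneg ?_ (by positivity)
  nlinarith [(Nat.cast_nonneg l : (0 : ℝ) ≤ l)]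

theorem aCoef_pos (l : ℕ) (h : 2 ≤ p ∨ 1 ≤ l) : 0 < aCoef p l := by
  have hp := one_le_cast p
  have hp' : (0 : ℝ) < p := by linarith
  rw [aCoef_eq]
  refine div_pos ?_ (by positivity)
  rcases h with h | h
  · have : (2 : ℝ) ≤ p := by exact_mod_cast h
    nlinarith [(Nat.cast_nonneg l : (0 : ℝ) ≤ l)]
  · have : (1 : ℝ) ≤ l := by exact_mod_cast h
    nlinarith

theorem aCoef_le (l : ℕ) : aCoef p l ≤ 1 / (l.factorial : ℝ) := by
  have hp := one_le_cast p
  have h1 : 1 / ((l.factorial : ℝ) * (p : ℝ) ^ l) ≤ 1 / (l.factorial : ℝ) := by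
    refine one_div_le_one_div_of_le (by positivity) ?_
    exact le_mul_of_one_le_right (by positivity) (one_le_pow₀ hp)
  have h2 : 0 ≤ 1 / (((l + 1).factorial : ℝ) * (p : ℝ) ^ (l + 1)) := by positivity
  rw [aCoef]; linarith

theorem levelWt_nonneg (l : ℕ) : 0 ≤ levelWt n p l := by
  unfold levelWt
  split_ifs
  · exact aCoef_nonneg l
  · positivity
  · exact le_rfl

theorem levelWt_le (l : ℕ) : levelWt n p l ≤ 1 / (l.factorial : ℝ) := by
  have hp := one_le_cast p
  unfold levelWt
  split_ifs with h1 h2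
  · exact aCoef_le l
  · subst h2
    refine one_div_le_one_div_of_le (by positivity) ?_
    exact le_mul_of_one_le_right (by positivity) (one_le_pow₀ hp)
  · positivity

/-- A level of positive probability is attained; no explicit deck is needed. -/
theorem exists_level_eq {l : ℕ} (hl : l < n) (h : 0 < aCoef p l) :
    ∃ x : ColPerm n p, level x = l := by
  classical
  by_contra! hx
  have := sum_unif_mul_level (n := n) (p := p) fun l' => if l' = l then 1 else 0
  simp [hx, levelWt, hl] at this
  exact h.ne this

theorem one_le_level (hn : 1 ≤ n) (x : ColPerm n 1) : 1 ≤ level x := by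
  rw [← mem_topSet_iff_le_level hn]
  refine ⟨fun i j hi hij => ?_, fun i _ => Subsingleton.elim _ _⟩
  rw [Fin.lt_def] at hij
  exact absurd j.2 (by omega)

theorem unif_pos (x : ColPerm n p) : 0 < unif (ColPerm n p) x := by
  have : 0 < Fintype.card (ColPerm n p) := Fintype.card_pos_iff.2 ⟨x⟩
  rw [unif]; positivity

/-! ### The distances expressed through the level -/

theorem lqNorm_rpow_mix {q : ℝ} (hq : 1 ≤ q) (P : ℕ → ℝ) :
    lqNorm (unif (ColPerm n p)) q (relDev (mix n p P) (unif (ColPerm n p))) ^ q =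
      ∑' l, levelWt n p l * |dens p P l - 1| ^ q := by
  rw [lqNorm, ← Real.rpow_mul (Finset.sum_nonneg fun x _ =>
    mul_nonneg (Real.rpow_nonneg (abs_nonneg _) _) (unif_pos x).le),
    one_div_mul_cancel (by linarith), Real.rpow_one, ← sum_unif_mul_level]
  simp only [relDev, mix_div_unif]

theorem tvDist_mix (P : ℕ → ℝ) :
    tvDist (mix n p P) (unif (ColPerm n p)) = 1 / 2 * ∑' l, levelWt n p l * |dens p P l - 1| := by
  rw [tvDist, ← sum_unif_mul_level fun l => |dens p P l - 1|]
  congr 1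
  refine Finset.sum_congr rfl fun x _ => ?_
  have hx := unif_pos x
  rw [← mix_div_unif, ← abs_of_pos hx, ← abs_mul, abs_of_pos hx, sub_mul, one_mul,
    div_mul_cancel₀ _ hx.ne']

theorem relEnt_mix (P : ℕ → ℝ) :
    relEnt (mix n p P) (unif (ColPerm n p)) =
      ∑' l, levelWt n p l * (dens p P l * Real.log (dens p P l)) := by
  rw [relEnt, ← sum_unif_mul_level fun l => dens p P l * Real.log (dens p P l)]
  refine Finset.sum_congr rfl fun x _ => ?_
  have hx := unif_pos x
  have : mix n p P x = dens p P (level x) * unif (ColPerm n p) x := by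
    rw [← mix_div_unif, div_mul_cancel₀ _ hx.ne']
  rw [mix_div_unif, this]
  ring

theorem sep_mix {P : ℕ → ℝ} (hP : ∀ u, 0 ≤ P u) {l : ℕ} (h1 : ∀ x : ColPerm n p, l ≤ level x)
    (h2 : ∃ x : ColPerm n p, level x = l) :
    sep (mix n p P) (unif (ColPerm n p)) = 1 - dens p P l := by
  obtain ⟨y, hy⟩ := h2
  have : Nonempty (ColPerm n p) := ⟨y⟩
  rw [sep]
  congr 1
  simp only [mix_div_unif]
  refine le_antisymm ?_ (le_ciInf fun x => dens_mono hP (h1 x))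
  rw [← hy]
  exact ciInf_le (Set.finite_range _).bddBelow y

theorem linfNorm_mix {P : ℕ → ℝ} (hP : ∀ u, 0 ≤ P u) {l : ℕ} (h1 : ∀ x : ColPerm n p, l ≤ level x)
    (h2 : ∃ x : ColPerm n p, level x = l) :
    linfNorm (relDev (mix n p P) (unif (ColPerm n p))) =
      max (dens p P n - 1) (1 - dens p P l) := by
  obtain ⟨y, hy⟩ := h2
  have : Nonempty (ColPerm n p) := ⟨y⟩
  have hb : BddAbove (Set.range fun x : ColPerm n p => |dens p P (level x) - 1|) :=
    (Set.finite_range _).bddAbove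
  simp only [linfNorm, relDev, mix_div_unif]
  refine le_antisymm (ciSup_le fun x => abs_le'.2 ⟨?_, ?_⟩) (max_le ?_ ?_)
  · exact le_max_of_le_left (sub_le_sub_right (dens_mono hP (level_le x)) _)
  · exact le_max_of_le_right (by linarith [dens_mono (p := p) hP (h1 x)])
  · refine le_trans (le_abs_self _) ?_
    have := le_ciSup hb (1 : ColPerm n p)
    rwa [level_one] at this
  · refine le_trans ?_ (le_ciSup hb y)
    rw [hy, ← neg_sub]
    exact neg_le_abs _

end

end ColoredShuffle

namespace ColoredShuffle

noncomputable section

/-! ### Asymptotics of the weights -/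

theorem lam_pos (c : ℝ) : 0 < lam c := Real.exp_pos _

theorem prod_ratio_nonneg {n m v : ℕ} (hv : v ≤ n) :
    0 ≤ ∏ j ∈ Finset.range m, ((n : ℝ) - j - v) / (n - j) := by
  rcases le_or_gt m (n - v) with h | h
  · refine Finset.prod_nonneg fun j hj => ?_
    have hj' : j < m := by simpa using hj
    have : ((j + v : ℕ) : ℝ) ≤ n := by exact_mod_cast (by omega : j + v ≤ n)
    push_cast at this
    exact div_nonneg (by linarith) (by linarith [(Nat.cast_nonneg v : (0 : ℝ) ≤ v)])
  · rw [Finset.prod_eq_zero (i := n - v) (by simpa using h)]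
    rw [Nat.cast_sub hv]; simp

theorem prod_ratio_le {n m v : ℕ} (hm : m ≤ n) (hv : v ≤ n) :
    ∏ j ∈ Finset.range m, ((n : ℝ) - j - v) / (n - j) ≤ Real.exp (-(v / n)) ^ m := by
  rcases le_or_gt m (n - v) with h | h
  · rw [show Real.exp (-(v / n : ℝ)) ^ m = ∏ j ∈ Finset.range m, Real.exp (-(v / n : ℝ)) by simp]
    refine Finset.prod_le_prod (fun j hj => ?_) fun j hj => ?_
    · have hj' : j < m := by simpa using hj
      have : ((j + v : ℕ) : ℝ) ≤ n := by exact_mod_cast (by omega : j + v ≤ n)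
      push_cast at this
      exact div_nonneg (by linarith) (by linarith [(Nat.cast_nonneg v : (0 : ℝ) ≤ v)])
    · have hj' : j < m := by simpa using hj
      have hjn : (j : ℝ) < n := by exact_mod_cast (by omega : j < n)
      have hj0 : (0 : ℝ) ≤ j := Nat.cast_nonneg j
      have hv0 : (0 : ℝ) ≤ v := Nat.cast_nonneg v
      have h1 : ((n : ℝ) - j - v) / (n - j) = 1 - v / (n - j) := by
        field_simp [(by linarith : (n : ℝ) - j ≠ 0)]
      have h2 : (v : ℝ) / n ≤ v / (n - j) :=
        div_le_div_of_nonneg_left hv0 (by linarith) (by linarith)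
      have h3 := Real.one_sub_le_exp_neg (v / n : ℝ)
      rw [h1]; linarith
  · rw [Finset.prod_eq_zero (i := n - v) (by simpa using h)]
    · positivity
    · rw [Nat.cast_sub hv]; simp

/-- Each factor is the inverse of `1 + v / (n - j - v)`, and `1 + x ≤ exp x`. -/
theorem le_prod_ratio {n m v : ℕ} (h : m + v < n) :
    Real.exp (-(v / (n - (m + v : ℕ)))) ^ m ≤
      ∏ j ∈ Finset.range m, ((n : ℝ) - j - v) / (n - j) := by
  rw [show Real.exp (-(v / (n - (m + v : ℕ)) : ℝ)) ^ m =
    ∏ j ∈ Finset.range m, Real.exp (-(v / (n - (m + v : ℕ)) : ℝ)) by simp]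
  refine Finset.prod_le_prod (fun j hj => (Real.exp_pos _).le) fun j hj => ?_
  have hj' : j < m := by simpa using hj
  have hjn : ((m + v : ℕ) : ℝ) < n := by exact_mod_cast h
  have hjm : (j : ℝ) < m := by exact_mod_cast hj'
  have hv0 : (0 : ℝ) ≤ v := Nat.cast_nonneg v
  push_cast at hjn ⊢
  have h0 : (0 : ℝ) < n - j - v := by linarith
  have h1 : (v : ℝ) / (n - j - v) ≤ v / (n - (m + v)) :=
    div_le_div_of_nonneg_left hv0 (by linarith) (by linarith)
  have h2 := Real.add_one_le_exp (v / (n - j - v) : ℝ)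
  have h3 : (v : ℝ) / (n - j - v) + 1 = (n - j) / (n - j - v) := by
    field_simp; ring
  calc Real.exp (-(v / (n - (m + v)))) ≤ Real.exp (-(v / (n - j - v))) :=
        Real.exp_le_exp.2 (neg_le_neg h1)
    _ = (Real.exp (v / (n - j - v)))⁻¹ := Real.exp_neg _
    _ ≤ ((n - j) / (n - j - v) : ℝ)⁻¹ := by
        rw [← h3]; exact inv_anti₀ (by positivity) h2
    _ = _ := inv_div _ _

/-- The `v`-th factorial moment, divided by `v!`, of the number of labels not drawn at time
`windowTime m c n`. -/
def binMoment (m : ℕ) (c : ℝ) (v n : ℕ) : ℝ :=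
  n.choose v * (∏ j ∈ Finset.range m, ((n : ℝ) - j - v) / (n - j)) ^ windowTime m c n

theorem binMoment_nonneg (n m : ℕ) (c : ℝ) (v : ℕ) : 0 ≤ binMoment m c v n := by
  rcases le_or_gt v n with h | h
  · exact mul_nonneg (by positivity) (pow_nonneg (prod_ratio_nonneg h) _)
  · simp [binMoment, Nat.choose_eq_zero_of_lt h]

theorem lt_windowTime {n m : ℕ} (hm : 1 ≤ m) (hn : 1 ≤ n) (c : ℝ) :
    Real.log n + c - m / n ≤ m * windowTime m c n / n := by
  have hm0 : (0 : ℝ) < m := by exact_mod_cast hm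
  have hn0 : (0 : ℝ) < n := by exact_mod_cast hn
  have h := (Nat.lt_floor_add_one ((n : ℝ) / m * (Real.log n + c))).le
  change _ ≤ (windowTime m c n : ℝ) + 1 at h
  have h2 : Real.log n + c ≤ (windowTime m c n + 1) * (m / n) := by
    calc Real.log n + c = (n : ℝ) / m * (Real.log n + c) * (m / n) := by field_simp
      _ ≤ _ := mul_le_mul_of_nonneg_right h (by positivity)
  have h3 : (windowTime m c n + 1 : ℝ) * (m / n) = m * windowTime m c n / n + m / n := by ring
  linarith

/-- The factor `exp (m / n)` is the price of rounding the time down. It is kept because it tends to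
`1`; the `L^∞` limit needs this sharp form. -/
theorem binMoment_le {n m : ℕ} (hm : 1 ≤ m) (hn : m ≤ n) (c : ℝ) (v : ℕ) :
    binMoment m c v n ≤ (lam c * Real.exp (m / n)) ^ v / v.factorial := by
  rcases le_or_gt v n with h | h
  · have hn0 : (0 : ℝ) < n := by exact_mod_cast (by omega : 0 < n)
    have h1 := pow_le_pow_left₀ (prod_ratio_nonneg h) (prod_ratio_le hn h) (windowTime m c n)
    have h2 : (Real.exp (-(v / n : ℝ)) ^ m) ^ windowTime m c n ≤
        (lam c * Real.exp (m / n) / n) ^ v := by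
      rw [← pow_mul, ← Real.exp_nat_mul]
      have : lam c * Real.exp (m / n) / n = Real.exp (-(Real.log n + c - m / n)) := by
        rw [lam, ← Real.exp_add, div_eq_mul_inv, ← Real.exp_log (inv_pos.2 hn0), ← Real.exp_add,
          Real.log_inv]
        congr 1; ring
      rw [this, ← Real.exp_nat_mul, Real.exp_le_exp]
      have h3 := mul_le_mul_of_nonneg_left (lt_windowTime hm (by omega : 1 ≤ n) c)
        (Nat.cast_nonneg v)
      push_cast
      calc (m : ℝ) * windowTime m c n * -(v / n) = -(v * (m * windowTime m c n / n)) := by ring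
        _ ≤ -(v * (Real.log n + c - m / n)) := neg_le_neg h3
        _ = _ := by ring
    calc binMoment m c v n ≤ (n : ℝ) ^ v / v.factorial * (lam c * Real.exp (m / n) / n) ^ v :=
          mul_le_mul (Nat.choose_le_pow_div v n) (h1.trans h2)
            (pow_nonneg (prod_ratio_nonneg h) _) (by positivity)
      _ = _ := by rw [div_pow]; field_simp
  · have := lam_pos c
    rw [binMoment, Nat.choose_eq_zero_of_lt h]
    simp only [Nat.cast_zero, zero_mul]
    positivity

theorem tendsto_natCast_div_sub (a : ℝ) :
    Tendsto (fun n : ℕ => (n : ℝ) / (n - a)) atTop (𝓝 1) := by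
  have h : Tendsto (fun n : ℕ => (1 - a / (n : ℝ))⁻¹) atTop (𝓝 (1 - 0)⁻¹) :=
    (tendsto_const_nhds.sub (tendsto_const_div_atTop_nhds_zero_nat a)).inv₀ (by norm_num)
  simp only [sub_zero, inv_one] at h
  refine h.congr' ?_
  filter_upwards [eventually_ge_atTop 1] with n hn
  have hn0 : (n : ℝ) ≠ 0 := by positivity
  rw [show 1 - a / (n : ℝ) = (n - a) / n by rw [sub_div, div_self hn0], inv_div]

theorem tendsto_log_div_sub (a : ℝ) :
    Tendsto (fun n : ℕ => Real.log n / (n - a)) atTop (𝓝 0) := by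
  have h0 : Tendsto (fun n : ℕ => Real.log n / n) atTop (𝓝 0) :=
    (Real.isLittleO_log_id_atTop.tendsto_div_nhds_zero).comp tendsto_natCast_atTop_atTop
  have h := h0.mul (tendsto_natCast_div_sub a)
  rw [zero_mul] at h
  refine h.congr' ?_
  filter_upwards [eventually_ge_atTop 1] with n hn
  have hn0 : (n : ℝ) ≠ 0 := by positivity
  field_simp

theorem tendsto_exp_div (m : ℕ) : Tendsto (fun n : ℕ => Real.exp (m / n)) atTop (𝓝 1) := by
  have := (Real.continuous_exp.tendsto 0).comp (tendsto_const_div_atTop_nhds_zero_nat (m : ℝ))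
  simpa [Function.comp_def] using this

theorem tendsto_choose_div_pow (v : ℕ) :
    Tendsto (fun n : ℕ => (n.choose v : ℝ) / (n : ℝ) ^ v) atTop (𝓝 (1 / v.factorial)) := by
  have h := (isEquivalent_choose v)
  have h2 := (Asymptotics.isEquivalent_iff_tendsto_one (by
    filter_upwards [eventually_ge_atTop 1] with n hn
    have hn0 : (n : ℝ) ≠ 0 := by positivity
    positivity)).1 h
  have h3 := h2.div_const (v.factorial : ℝ)
  refine h3.congr' ?_
  filter_upwards [eventually_ge_atTop 1] with n hn
  have hn0 : (n : ℝ) ≠ 0 := by positivity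
  simp only [Pi.div_apply]
  field_simp

theorem tendsto_binMoment {m : ℕ} (hm : 1 ≤ m) (c : ℝ) (v : ℕ) :
    Tendsto (binMoment m c v) atTop (𝓝 (lam c ^ v / v.factorial)) := by
  have hlow : Tendsto (fun n : ℕ => (n.choose v : ℝ) / (n : ℝ) ^ v *
      Real.exp (-(v * c) * (n / (n - (m + v : ℕ))) -
        v * (m + v) * (Real.log n / (n - (m + v : ℕ))))) atTop (𝓝 (lam c ^ v / v.factorial)) := by
    have h1 := ((tendsto_natCast_div_sub ((m + v : ℕ) : ℝ)).const_mul (-(v * c))).sub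
      ((tendsto_log_div_sub ((m + v : ℕ) : ℝ)).const_mul (v * (m + v) : ℝ))
    have h2 := (tendsto_choose_div_pow v).mul ((Real.continuous_exp.tendsto _).comp h1)
    have h3 : (1 / v.factorial : ℝ) * Real.exp (-(v * c) * 1 - v * (m + v) * 0) =
        lam c ^ v / v.factorial := by
      rw [lam, ← Real.exp_nat_mul, mul_one, mul_zero, sub_zero, ← mul_neg, one_div_mul_eq_div]
    rw [h3] at h2
    exact h2
  have hup : Tendsto (fun n : ℕ => (lam c * Real.exp (m / n)) ^ v / v.factorial) atTop
      (𝓝 (lam c ^ v / v.factorial)) := by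
    have := (((tendsto_exp_div m).const_mul (lam c)).pow v).div_const (v.factorial : ℝ)
    simpa using this
  refine tendsto_of_tendsto_of_tendsto_of_le_of_le' hlow hup ?_ ?_
  · have hlog : ∀ᶠ n : ℕ in atTop, -c ≤ Real.log n :=
      (Real.tendsto_log_atTop.comp tendsto_natCast_atTop_atTop).eventually_ge_atTop (-c)
    filter_upwards [hlog, eventually_gt_atTop (m + v)] with n hn1 hn2
    have hm0 : (0 : ℝ) < m := by exact_mod_cast hm
    have hn0 : (0 : ℝ) < n := by exact_mod_cast (by omega : 0 < n)
    have hn3 : (0 : ℝ) < n - (m + v : ℕ) := by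
      have : ((m + v : ℕ) : ℝ) < n := by exact_mod_cast hn2
      linarith
    have h1 := pow_le_pow_left₀ (by positivity) (le_prod_ratio hn2) (windowTime m c n)
    have h2 : m * (windowTime m c n : ℝ) ≤ n * (Real.log n + c) := by
      have := Nat.floor_le (a := (n : ℝ) / m * (Real.log n + c))
        (mul_nonneg (by positivity) (by linarith))
      calc m * (windowTime m c n : ℝ) ≤ m * ((n : ℝ) / m * (Real.log n + c)) :=
            mul_le_mul_of_nonneg_left this hm0.le
        _ = _ := by field_simp
    rw [div_mul_eq_mul_div, mul_div_assoc, binMoment]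
    refine mul_le_mul_of_nonneg_left (le_trans ?_ h1) (by positivity)
    have h4 : (n : ℝ) ^ v = Real.exp (v * Real.log n) := by
      rw [Real.exp_nat_mul, Real.exp_log hn0]
    rw [h4, ← Real.exp_sub, ← pow_mul, ← Real.exp_nat_mul, Real.exp_le_exp]
    have h5 : -(v * c) * ((n : ℝ) / (n - (m + v : ℕ))) -
        v * (m + v) * (Real.log n / (n - (m + v : ℕ))) - v * Real.log n =
        -(v / (n - (m + v : ℕ))) * (n * (Real.log n + c)) := by
      field_simp
      push_cast
      ring
    rw [h5]
    push_cast at h2 hn3 ⊢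
    have : 0 ≤ (v : ℝ) / (n - (m + v)) := by positivity
    nlinarith
  · filter_upwards [eventually_ge_atTop m] with n hn
    exact binMoment_le hm hn c v

/-- The law at time `windowTime m c n` of the number of labels not drawn. -/
def windowLaw (m : ℕ) (c : ℝ) (n : ℕ) : ℕ → ℝ := undrawn n m (windowTime m c n)

theorem windowLaw_nonneg {n m : ℕ} (hm : m ≤ n) (c : ℝ) (u : ℕ) : 0 ≤ windowLaw m c n u :=
  undrawn_nonneg hm _ u

theorem sum_choose_mul_windowLaw {n m : ℕ} (hm : m ≤ n) (c : ℝ) (v : ℕ) :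
    ∑ u ∈ Finset.range (n + 1), (u.choose v : ℝ) * windowLaw m c n u = binMoment m c v n :=
  sum_choose_mul_undrawn hm v _

/-- The weight at `u` is a single term of the `u`-th binomial moment, where its coefficient is `1`.
-/
theorem windowLaw_le {n m : ℕ} (hm : 1 ≤ m) (hn : m ≤ n) (c : ℝ) (u : ℕ) :
    windowLaw m c n u ≤ (lam c * Real.exp (m / n)) ^ u / u.factorial := by
  refine le_trans ?_ (binMoment_le hm hn c u)
  rcases le_or_gt u n with h | h
  · rw [← sum_choose_mul_windowLaw hn]
    have := Finset.single_le_sum (f := fun w : ℕ => (w.choose u : ℝ) * windowLaw m c n w)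
      (s := Finset.range (n + 1)) (fun w _ => mul_nonneg (Nat.cast_nonneg _)
        (windowLaw_nonneg hn c w)) (Finset.mem_range.2 (Nat.lt_succ_of_le h))
    simpa using this
  · rw [windowLaw, undrawn_support _ _ u h]
    exact binMoment_nonneg n m c u

/-! ### Binomial inversion and the Poisson limit -/

theorem sum_alternating_choose_mul_choose (n w u : ℕ) (hw : w ≤ n) :
    ∑ v ∈ Finset.range (n + 1), (-1 : ℝ) ^ (v + u) * v.choose u * w.choose v =
      if w = u then 1 else 0 := by
  have h1 : ∀ v ∈ Finset.range (n + 1), v ∉ Finset.Ico u (w + 1) →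
      (-1 : ℝ) ^ (v + u) * v.choose u * w.choose v = 0 := by
    intro v _ hv
    rw [Finset.mem_Ico, not_and_or] at hv
    rcases hv with hv | hv
    · rw [Nat.choose_eq_zero_of_lt (by omega : v < u)]; simp
    · rw [Nat.choose_eq_zero_of_lt (by omega : w < v)]; simp
  have hsub : Finset.Ico u (w + 1) ⊆ Finset.range (n + 1) := by
    intro v hv
    simp only [Finset.mem_Ico, Finset.mem_range] at *
    omega
  rw [← Finset.sum_subset hsub h1]
  rcases le_or_gt u w with h | h
  · rw [Finset.sum_Ico_eq_sum_range, (by omega : w + 1 - u = w - u + 1)]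
    have h2 : ∀ i ∈ Finset.range (w - u + 1),
        (-1 : ℝ) ^ (u + i + u) * (u + i).choose u * w.choose (u + i) =
        w.choose u * (((-1 : ℤ) ^ i * ((w - u).choose i : ℤ) : ℤ) : ℝ) := by
      intro i _
      have h3 : (w.choose (u + i) : ℝ) * (u + i).choose u = w.choose u * (w - u).choose i := by
        have := Nat.choose_mul (n := w) (k := u + i) (s := u) (by omega)
        rw [Nat.add_sub_cancel_left] at this
        exact_mod_cast this
      have h4 : (-1 : ℝ) ^ (u + i + u) = (-1) ^ i := by
        rw [show u + i + u = i + 2 * u by ring, pow_add, pow_mul]; simp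
      push_cast
      rw [h4, mul_assoc, mul_comm ((u + i).choose u : ℝ), h3]; ring
    rw [Finset.sum_congr rfl h2, ← Finset.mul_sum, ← Int.cast_sum, Int.alternating_sum_range_choose]
    by_cases hwu : w = u
    · subst hwu; simp
    · rw [if_neg (by omega), if_neg hwu]; simp
  · rw [Finset.Ico_eq_empty (by omega), if_neg (by omega)]; simp

theorem windowLaw_eq_sum {n m : ℕ} (hm : m ≤ n) (c : ℝ) {u : ℕ} (hu : u ≤ n) :
    windowLaw m c n u =
      ∑ v ∈ Finset.range (n + 1), (-1 : ℝ) ^ (v + u) * v.choose u * binMoment m c v n := by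
  simp only [← sum_choose_mul_windowLaw hm, Finset.mul_sum]
  rw [Finset.sum_comm]
  have h1 : ∀ w ∈ Finset.range (n + 1), ∑ v ∈ Finset.range (n + 1),
      (-1 : ℝ) ^ (v + u) * v.choose u * (w.choose v * windowLaw m c n w) =
      if w = u then windowLaw m c n w else 0 := by
    intro w hw
    have := sum_alternating_choose_mul_choose n w u (by simpa [Nat.lt_succ_iff] using hw)
    simp only [← mul_assoc, ← Finset.sum_mul, this]
    simp
  rw [Finset.sum_congr rfl h1, Finset.sum_ite_eq', if_pos (by simpa [Nat.lt_succ_iff] using hu)]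

theorem hasSum_exp (x : ℝ) : HasSum (fun n : ℕ => x ^ n / (n.factorial : ℝ)) (Real.exp x) := by
  rw [Real.exp_eq_exp_ℝ]
  exact NormedSpace.expSeries_div_hasSum_exp x

theorem hasSum_alternating_choose (x : ℝ) (u : ℕ) :
    HasSum (fun v : ℕ => (-1 : ℝ) ^ (v + u) * v.choose u * (x ^ v / v.factorial))
      (Real.exp (-x) * (x ^ u / u.factorial)) := by
  rw [← hasSum_nat_add_iff' u]
  have h0 : ∑ i ∈ Finset.range u, (-1 : ℝ) ^ (i + u) * i.choose u * (x ^ i / i.factorial) = 0 := by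
    refine Finset.sum_eq_zero fun i hi => ?_
    rw [Nat.choose_eq_zero_of_lt (by simpa using hi)]; simp
  rw [h0, sub_zero]
  have key : ∀ i : ℕ, (-1 : ℝ) ^ (i + u + u) * (i + u).choose u *
      (x ^ (i + u) / (i + u).factorial) = (-x) ^ i / i.factorial * (x ^ u / u.factorial) := by
    intro i
    have h1 : ((i + u).choose u : ℝ) * u.factorial * i.factorial = (i + u).factorial := by
      have := Nat.add_choose_mul_factorial_mul_factorial u i
      rw [← Nat.choose_symm_add, add_comm u i] at this
      exact_mod_cast this
    have h2 : (-1 : ℝ) ^ (i + u + u) = (-1) ^ i := by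
      rw [show i + u + u = i + 2 * u by ring, pow_add, pow_mul]; simp
    have h3 : ((i + u).choose u : ℝ) ≠ 0 := by
      exact_mod_cast (Nat.choose_pos (Nat.le_add_left u i)).ne'
    rw [h2, ← h1, neg_pow x i, pow_add]
    field_simp
  simp only [key]
  exact (hasSum_exp (-x)).mul_right _

/-- The inversion formula is a series in binomial moments, each convergent, and `choose v u ≤ 2 ^ v`
together with `binMoment_le` dominates it by an exponential series. -/
theorem tendsto_windowLaw {m : ℕ} (hm : 1 ≤ m) (c : ℝ) (u : ℕ) :
    Tendsto (fun n => windowLaw m c n u) atTop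
      (𝓝 (Real.exp (-lam c) * (lam c ^ u / u.factorial))) := by
  have hl := lam_pos c
  have key : Tendsto (fun n => ∑' v : ℕ, (-1 : ℝ) ^ (v + u) * v.choose u * binMoment m c v n) atTop
      (𝓝 (∑' v : ℕ, (-1 : ℝ) ^ (v + u) * v.choose u * (lam c ^ v / v.factorial))) := by
    refine tendsto_tsum_of_dominated_convergence
      (bound := fun v => (2 * (lam c * Real.exp m)) ^ v / v.factorial) (hasSum_exp _).summable
      (fun v => (tendsto_binMoment hm c v).const_mul _) ?_
    filter_upwards [eventually_ge_atTop m] with n hn v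
    have hn1 : (1 : ℝ) ≤ n := by exact_mod_cast hm.trans hn
    have h1 : (v.choose u : ℝ) ≤ 2 ^ v := by exact_mod_cast Nat.choose_le_two_pow v u
    have h2 : binMoment m c v n ≤ (lam c * Real.exp m) ^ v / v.factorial := by
      refine (binMoment_le hm hn c v).trans ?_
      have : (m : ℝ) / n ≤ m := div_le_self (Nat.cast_nonneg m) hn1
      gcongr
    rw [norm_mul, norm_mul, norm_pow, norm_neg, norm_one, one_pow, one_mul,
      Real.norm_of_nonneg (Nat.cast_nonneg _), Real.norm_of_nonneg (binMoment_nonneg n m c v),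
      mul_pow, mul_div_assoc]
    exact mul_le_mul h1 h2 (binMoment_nonneg n m c v) (by positivity)
  rw [(hasSum_alternating_choose (lam c) u).tsum_eq] at key
  refine key.congr' ?_
  filter_upwards [eventually_ge_atTop m, eventually_ge_atTop u] with n hn hu
  rw [windowLaw_eq_sum hn c hu, tsum_eq_sum]
  intro v hv
  rw [binMoment, Nat.choose_eq_zero_of_lt (by simpa [Nat.lt_succ_iff] using hv : n < v)]
  simp

end

end ColoredShuffle

namespace ColoredShuffle

noncomputable section

/-! ### The limit profiles in closed form -/

theorem hasSum_of_eq {f g : ℕ → ℝ} {a b : ℝ} (h : HasSum f a) (hfg : ∀ l, g l = f l)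
    (hab : b = a) : HasSum g b := by
  obtain rfl : g = f := funext hfg
  rwa [hab]

variable {p : ℕ}

theorem sSum_succ (c : ℝ) (l : ℕ) :
    sSum p c (l + 1) = sSum p c l + Real.exp (-lam c) * rat p c ^ (l + 1) := by
  rw [sSum, Finset.sum_range_succ, mul_add]; rfl

theorem sSum_zero (c : ℝ) : sSum p c 0 = Real.exp (-lam c) := by simp [sSum]
variable [NeZero p]

theorem rat_pos (c : ℝ) : 0 < rat p c :=
  mul_pos (by linarith [one_le_cast p]) (lam_pos c)

theorem sSum_strictMono (c : ℝ) : StrictMono (sSum p c) := by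
  refine strictMono_nat_of_lt_succ fun l => ?_
  have := rat_pos (p := p) c
  rw [sSum_succ]
  exact lt_add_of_pos_right _ (by positivity)

theorem sSum_pos (c : ℝ) (l : ℕ) : 0 < sSum p c l :=
  lt_of_lt_of_le (by rw [sSum_zero]; exact Real.exp_pos _)
    ((sSum_strictMono (p := p) c).monotone (Nat.zero_le l))

theorem geom_sum_le_one_add_pow {x : ℝ} (hx : 0 ≤ x) (l : ℕ) :
    ∑ u ∈ Finset.range (l + 1), x ^ u ≤ (1 + x) ^ l := by
  induction l with
  | zero => simp
  | succ l ih =>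
    rw [Finset.sum_range_succ, pow_succ (1 + x), pow_succ x]
    have : x ^ l ≤ (1 + x) ^ l := pow_le_pow_left₀ hx (by linarith) l
    nlinarith

theorem sSum_le (c : ℝ) (l : ℕ) : sSum p c l ≤ (1 + rat p c) ^ l := by
  have hr := rat_pos (p := p) c
  have h1 : Real.exp (-lam c) ≤ 1 := Real.exp_le_one_iff.2 (by linarith [lam_pos c])
  refine le_trans ?_ (geom_sum_le_one_add_pow hr.le l)
  exact mul_le_of_le_one_left (by positivity) h1

/-! ### Summation by parts against `aCoef` -/

theorem summable_of_abs_le_pow {w F : ℕ → ℝ} {C : ℝ} (hw : ∀ l, 0 ≤ w l)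
    (hw' : ∀ l, w l ≤ 1 / (l.factorial : ℝ)) (hF : ∀ l, |F l| ≤ C ^ l) :
    Summable fun l => w l * F l := by
  refine Summable.of_norm_bounded (hasSum_exp C).summable fun l => ?_
  rw [norm_mul, Real.norm_of_nonneg (hw l), Real.norm_eq_abs, ← one_div_mul_eq_div]
  exact mul_le_mul (hw' l) (hF l) (abs_nonneg _) (by positivity)

/-- Abel summation: `aCoef p l` is a difference of consecutive values of `1 / (l! p^l)`, so the
difference moves onto `F`. The growth bound makes the two halves summable separately. When an
increment carries a factor `r^l`, the weight `1 / (l! p^l)` turns it into `λ^l / l!`, which is how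
the closed forms arise. -/
theorem hasSum_aCoef_mul {F G : ℕ → ℝ} {C S : ℝ} (hF : ∀ l, |F l| ≤ C ^ l) (h0 : G 0 = F 0)
    (hG : ∀ l, G (l + 1) = F (l + 1) - F l)
    (hS : HasSum (fun l : ℕ => 1 / ((l.factorial : ℝ) * (p : ℝ) ^ l) * G l) S) :
    HasSum (fun l => aCoef p l * F l) S := by
  have hT : Summable fun l : ℕ => 1 / ((l.factorial : ℝ) * (p : ℝ) ^ l) * F l := by
    refine summable_of_abs_le_pow (fun l => by positivity) (fun l => ?_) hF
    exact one_div_le_one_div_of_le (by positivity)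
      (le_mul_of_one_le_right (by positivity) (one_le_pow₀ (one_le_cast p)))
  obtain ⟨T, hT⟩ := hT
  have h := hT.sub (((hasSum_nat_add_iff' 1).2 hT).sub ((hasSum_nat_add_iff' 1).2 hS))
  simp only [Finset.sum_range_one, h0, hG] at h
  exact hasSum_of_eq h (fun l => by rw [aCoef]; ring) (by ring)

theorem hasSum_aCoef (p : ℕ) [NeZero p] : HasSum (aCoef p) 1 := by
  have := hasSum_aCoef_mul (p := p) (F := fun _ => 1) (G := fun l => if l = 0 then 1 else 0)
    (C := 1) (S := 1) (by simp) (by simp) (by simp) ?_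
  · simpa using this
  · convert hasSum_ite_eq (0 : ℕ) (1 : ℝ) using 2 with l
    by_cases hl : l = 0 <;> simp [hl]

theorem inv_factorial_mul_rat_pow (c : ℝ) (l : ℕ) (x : ℝ) :
    1 / ((l.factorial : ℝ) * (p : ℝ) ^ l) * (x * rat p c ^ l) = x * (lam c ^ l / l.factorial) := by
  have hp : (p : ℝ) ≠ 0 := NeZero.ne _
  rw [rat, mul_pow]
  field_simp

theorem abs_sSum_le (c : ℝ) (l : ℕ) : |sSum p c l| ≤ (1 + rat p c) ^ l := by
  rw [abs_of_pos (sSum_pos c l)]; exact sSum_le c l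

theorem hasSum_aCoef_mul_sSum (c : ℝ) : HasSum (fun l => aCoef p l * sSum p c l) 1 := by
  refine hasSum_aCoef_mul (G := fun l => Real.exp (-lam c) * rat p c ^ l) (abs_sSum_le c)
    (by simp [sSum_zero]) (fun l => by rw [sSum_succ]; ring) ?_
  simp only [inv_factorial_mul_rat_pow]
  have := (hasSum_exp (lam c)).mul_left (Real.exp (-lam c))
  rwa [← Real.exp_add, neg_add_cancel, Real.exp_zero] at this

theorem hasSum_aCoef_mul_sSum_sub_one (c : ℝ) :
    HasSum (fun l => aCoef p l * (sSum p c l - 1)) 0 := by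
  have := (hasSum_aCoef_mul_sSum (p := p) c).sub (hasSum_aCoef p)
  simpa [mul_sub] using this

/-- The average of `sSum - 1` is `0`. Were it never positive, it would vanish wherever `aCoef` is
positive, in particular at `l = 1` and `l = 2`, against strict monotonicity. Level `0` is avoided
because `aCoef 1 0 = 0`. -/
theorem exists_one_lt_sSum (p : ℕ) [NeZero p] (c : ℝ) : ∃ l, 1 < sSum p c l := by
  by_contra! h
  have h1 : HasSum (fun l => aCoef p l * (1 - sSum p c l)) 0 := by
    have := (hasSum_aCoef_mul_sSum_sub_one (p := p) c).neg
    rw [neg_zero] at this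
    exact hasSum_of_eq this (fun l => by ring) rfl
  have h2 := (hasSum_zero_iff_of_nonneg fun l =>
    mul_nonneg (aCoef_nonneg (p := p) l) (sub_nonneg.2 (h l))).1 h1
  have h3 : ∀ l, 1 ≤ l → sSum p c l = 1 := by
    intro l hl
    have h4 : aCoef p l * (1 - sSum p c l) = 0 := congrFun h2 l
    rcases mul_eq_zero.1 h4 with h5 | h5
    · exact absurd h5 (aCoef_pos l (Or.inr hl)).ne'
    · linarith
  have h4 := sSum_strictMono (p := p) c (by norm_num : 1 < 2)
  rw [h3 1 le_rfl, h3 2 (by norm_num)] at h4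
  exact lt_irrefl _ h4

theorem one_lt_sSum_iff (c : ℝ) (l : ℕ) : 1 < sSum p c l ↔ wStar p c ≤ l := by
  constructor
  · exact fun h => Nat.sInf_le h
  · intro h
    exact lt_of_lt_of_le (Nat.sInf_mem (exists_one_lt_sSum p c))
      ((sSum_strictMono (p := p) c).monotone h)

theorem abs_sub_one_le {x B : ℝ} (hx : 0 ≤ x) (hxB : x ≤ B) (hB : 1 ≤ B) : |x - 1| ≤ B :=
  abs_le.2 ⟨by linarith, by linarith⟩

theorem hasSum_aCoef_mul_posPart (c : ℝ) :
    HasSum (fun l => aCoef p l * max (sSum p c l - 1) 0) (fProf p c) := by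
  have hr := rat_pos (p := p) c
  set w := wStar p c with hw
  set D : ℝ := Real.exp (-lam c) * ∑ u ∈ Finset.range w, rat p c ^ u - 1 with hD
  have hsw : sSum p c w - 1 = Real.exp (-lam c) * rat p c ^ w + D := by
    rw [sSum, Finset.sum_range_succ, hD]; ring
  have hge : ∀ l, w ≤ l → max (sSum p c l - 1) 0 = sSum p c l - 1 := fun l hl =>
    max_eq_left (by linarith [(one_lt_sSum_iff c l).2 hl])
  have hlt : ∀ l, l < w → max (sSum p c l - 1) 0 = 0 := fun l hl =>
    max_eq_right (by
      have := mt (one_lt_sSum_iff c l).1 (not_le.2 hl)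
      linarith)
  -- The increments of the positive part are `0` below `w` and those of `sSum` above it. At `w` the
  -- whole value `sSum p c w - 1` appears at once, which exceeds the increment of `sSum` by `D`. The
  -- first kind gives the Poisson tail in `fProf`, the second its last summand.
  refine hasSum_aCoef_mul (C := 1 + rat p c)
    (G := fun l => ((Real.exp (-lam c) * rat p c ^ l) -
      (if l ∈ Finset.range w then Real.exp (-lam c) * rat p c ^ l else 0)) +
      if l = w then D else 0) (fun l => ?_) ?_ (fun l => ?_) ?_
  · rw [abs_of_nonneg (le_max_right _ _)]
    exact max_le (by linarith [sSum_le (p := p) c l]) (by positivity)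
  · simp only [Finset.mem_range]
    rcases Nat.eq_zero_or_pos w with h | h
    · rw [hge 0 h.le, ← h, if_neg (lt_irrefl _), if_pos rfl, sub_zero, hsw]
    · rw [hlt 0 h, if_pos h, if_neg h.ne]; ring
  · simp only [Finset.mem_range]
    rcases lt_trichotomy (l + 1) w with h | h | h
    · rw [if_pos h, if_neg h.ne, hlt _ h, hlt l (by omega)]; ring
    · rw [if_neg h.not_lt, if_pos h, hge _ h.ge, hlt l (by omega), h, hsw]; ring
    · rw [if_neg h.not_gt, if_neg h.ne', hge _ h.le, hge l (by omega), sSum_succ]; ring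
  · have e1 := (hasSum_exp (lam c)).mul_left (Real.exp (-lam c))
    rw [← Real.exp_add, neg_add_cancel, Real.exp_zero] at e1
    have e2 : HasSum (fun l => if l ∈ Finset.range w then
        Real.exp (-lam c) * (lam c ^ l / l.factorial) else 0)
        (∑ l ∈ Finset.range w, Real.exp (-lam c) * (lam c ^ l / l.factorial)) := by
      have := hasSum_sum_of_ne_finset_zero (L := .unconditional ℕ) (s := Finset.range w) (f := fun l =>
        if l ∈ Finset.range w then Real.exp (-lam c) * (lam c ^ l / l.factorial) else 0)
        (fun l hl => if_neg hl)
      rwa [Finset.sum_congr rfl fun l hl => if_pos hl] at this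
    have e3 := hasSum_ite_eq w (1 / ((w.factorial : ℝ) * (p : ℝ) ^ w) * D)
    have e4 := (e1.sub e2).add e3
    refine hasSum_of_eq e4 (fun l => ?_) ?_
    · rw [mul_add, mul_sub, inv_factorial_mul_rat_pow, mul_ite, mul_ite,
        inv_factorial_mul_rat_pow, mul_zero]
      congr 1
      split_ifs with h
      · rw [h]
      · rfl
    · rw [← Finset.mul_sum, one_div_mul_eq_div]; rfl

/-- Positive and negative parts have equal averages because `sSum - 1` averages to `0`. Unlike the
positive part, this one is bounded by `1` uniformly in `c`. -/
theorem hasSum_aCoef_mul_negPart (c : ℝ) :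
    HasSum (fun l => aCoef p l * max (1 - sSum p c l) 0) (fProf p c) := by
  have h := (hasSum_aCoef_mul_posPart (p := p) c).sub (hasSum_aCoef_mul_sSum_sub_one (p := p) c)
  rw [sub_zero] at h
  refine hasSum_of_eq h (fun l => ?_) rfl
  rw [← mul_sub, max_def, max_def]
  congr 1
  split_ifs <;> linarith

theorem hasSum_aCoef_mul_abs (c : ℝ) :
    HasSum (fun l => aCoef p l * |sSum p c l - 1|) (2 * fProf p c) := by
  have h := (hasSum_aCoef_mul_posPart (p := p) c).add (hasSum_aCoef_mul_negPart (p := p) c)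
  refine hasSum_of_eq h (fun l => ?_) (two_mul _)
  rw [← mul_add]
  congr 1
  rcases le_total (sSum p c l) 1 with h1 | h1
  · rw [abs_of_nonpos (by linarith), max_eq_right (by linarith), max_eq_left (by linarith)]; ring
  · rw [abs_of_nonneg (by linarith), max_eq_left (by linarith), max_eq_right (by linarith)]; ring

/-- The increment of the square is `e * r^l` times the sum of two consecutive values of `sSum`.
Evaluating that geometric sum leaves exponential series in `λ` and `λ r`, or, when `r = 1`, the
first Poisson moment. -/
theorem hasSum_aCoef_mul_sq (c : ℝ) :
    HasSum (fun l => aCoef p l * sSum p c l ^ 2) (gProf p c + 1) := by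
  set e := Real.exp (-lam c) with he
  set r := rat p c with hr'
  have hr : 0 < r := rat_pos c
  have hee : Real.exp (-lam c) * Real.exp (lam c) = 1 := by
    rw [← Real.exp_add, neg_add_cancel, Real.exp_zero]
  refine hasSum_aCoef_mul (C := (1 + r) ^ 2)
    (G := fun l => e * (e * (2 * ∑ u ∈ Finset.range l, r ^ u + r ^ l)) * r ^ l)
    (fun l => ?_) ?_ (fun l => ?_) ?_
  · rw [abs_of_nonneg (sq_nonneg _), ← pow_mul, mul_comm 2 l, pow_mul]
    exact pow_le_pow_left₀ (sSum_pos c l).le (sSum_le c l) 2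
  · simp [sSum_zero, he, sq]
  · rw [sSum_succ, sSum]
    ring
  · have h1 : ∀ l : ℕ, 1 / ((l.factorial : ℝ) * (p : ℝ) ^ l) *
        (e * (e * (2 * ∑ u ∈ Finset.range l, r ^ u + r ^ l)) * r ^ l) =
        e * (e * (2 * ∑ u ∈ Finset.range l, r ^ u + r ^ l)) * (lam c ^ l / l.factorial) :=
      fun l => inv_factorial_mul_rat_pow c l _
    simp only [h1]
    by_cases h : r = 1
    · have h2 : gProf p c + 1 = e * (e * (2 * (lam c * Real.exp (lam c)) + Real.exp (lam c))) := by
        rw [gProf, if_pos h]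
        linear_combination (-(e * (2 * lam c + 1))) * hee
      rw [h2]
      have h3 : HasSum (fun l : ℕ => (l : ℝ) * (lam c ^ l / l.factorial))
          (lam c * Real.exp (lam c)) := by
        rw [← hasSum_nat_add_iff' 1]
        have := (hasSum_exp (lam c)).mul_left (lam c)
        simp only [Finset.sum_range_one, Nat.cast_zero, zero_mul, sub_zero]
        refine hasSum_of_eq this (fun l => ?_) rfl
        rw [Nat.factorial_succ, pow_succ]
        push_cast
        field_simp
      have h4 := (((h3.mul_left 2).add (hasSum_exp (lam c))).mul_left e).mul_left e
      exact hasSum_of_eq h4 (fun l => by simp [h]; ring) rfl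
    · have hr1 : r - 1 ≠ 0 := sub_ne_zero.2 h
      have h2 : gProf p c + 1 = e * (e * ((r + 1) / (r - 1) * Real.exp (lam c * r) -
          2 / (r - 1) * Real.exp (lam c))) := by
        have h5 : Real.exp (-(lam c * (2 - r))) = e * (e * Real.exp (lam c * r)) := by
          rw [he, ← Real.exp_add, ← Real.exp_add]; congr 1; ring
        rw [gProf, if_neg h, ← hr', h5]
        linear_combination (2 / (r - 1) * e) * hee
      rw [h2]
      have h4 := ((((hasSum_exp (lam c * r)).mul_left ((r + 1) / (r - 1))).sub
        ((hasSum_exp (lam c)).mul_left (2 / (r - 1)))).mul_left e).mul_left e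
      refine hasSum_of_eq h4 (fun l => ?_) rfl
      rw [geom_sum_eq h, mul_pow]
      field_simp
      ring

theorem hqProf_two (c : ℝ) : hqProf 2 p c = gProf p c := by
  have h := ((hasSum_aCoef_mul_sq (p := p) c).sub
    ((hasSum_aCoef_mul_sSum (p := p) c).mul_left 2)).add (hasSum_aCoef p)
  have h2 : HasSum (hqTerm 2 p c) (gProf p c) := by
    exact hasSum_of_eq h (fun l => by rw [hqTerm, Real.rpow_two, sq_abs]; ring) (by ring)
  exact h2.tsum_eq

/-! ### Range and end behavior of the total-variation profile -/

theorem fProf_mem_Icc (c : ℝ) : fProf p c ∈ Set.Icc (0 : ℝ) 1 := by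
  constructor
  · exact (hasSum_aCoef_mul_negPart (p := p) c).nonneg fun l =>
      mul_nonneg (aCoef_nonneg (p := p) l) (le_max_right _ _)
  · refine hasSum_le (fun l => ?_) (hasSum_aCoef_mul_negPart (p := p) c) (hasSum_aCoef p)
    exact mul_le_of_le_one_right (aCoef_nonneg l)
      (max_le (by linarith [sSum_pos (p := p) c l]) zero_le_one)

/-- The negative-part series is dominated by `aCoef p` for every `c`, so termwise limits suffice. It
is applied with `x = 1` at `+∞` and `x = 0` at `-∞`. -/
theorem tendsto_fProf_of_tendsto_sSum {F : Filter ℝ} {x : ℝ} (hx1 : x ≤ 1)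
    (h : ∀ l, Tendsto (fun c => sSum p c l) F (𝓝 x)) : Tendsto (fProf p) F (𝓝 (1 - x)) := by
  have h1 : Tendsto (fun c => ∑' l, aCoef p l * max (1 - sSum p c l) 0) F
      (𝓝 (∑' l, aCoef p l * max (1 - x) 0)) := by
    refine tendsto_tsum_of_dominated_convergence (bound := aCoef p) (hasSum_aCoef p).summable
      (fun l => ((tendsto_const_nhds.sub (h l)).max tendsto_const_nhds).const_mul _)
      (Eventually.of_forall fun c l => ?_)
    rw [norm_mul, Real.norm_of_nonneg (aCoef_nonneg l), Real.norm_of_nonneg (le_max_right _ _)]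
    exact mul_le_of_le_one_right (aCoef_nonneg l)
      (max_le (by linarith [sSum_pos (p := p) c l]) zero_le_one)
  rw [tsum_mul_right, (hasSum_aCoef p).tsum_eq, one_mul, max_eq_left (by linarith)] at h1
  exact h1.congr fun c => (hasSum_aCoef_mul_negPart c).tsum_eq

theorem tendsto_fProf_atTop : Tendsto (fProf p) atTop (𝓝 0) := by
  have hl : Tendsto lam atTop (𝓝 0) := Real.tendsto_exp_neg_atTop_nhds_zero
  have := tendsto_fProf_of_tendsto_sSum (p := p) (F := atTop) le_rfl fun l => ?_
  · simpa using this
  · have hc : Continuous fun x : ℝ =>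
        Real.exp (-x) * ∑ u ∈ Finset.range (l + 1), ((p : ℝ) * x) ^ u := by fun_prop
    have h := (hc.tendsto 0).comp hl
    have h0 : Real.exp (-0) * ∑ u ∈ Finset.range (l + 1), ((p : ℝ) * 0) ^ u = 1 := by
      rw [Finset.sum_range_succ']; simp
    rw [h0] at h
    exact h

theorem tendsto_fProf_atBot : Tendsto (fProf p) atBot (𝓝 1) := by
  have hl : Tendsto lam atBot atTop := Real.tendsto_exp_atTop.comp tendsto_neg_atBot_atTop
  have := tendsto_fProf_of_tendsto_sSum (p := p) (F := atBot) zero_le_one fun l => ?_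
  · simpa using this
  · have h : Tendsto (fun x : ℝ => ∑ u ∈ Finset.range (l + 1),
        (p : ℝ) ^ u * (x ^ u * Real.exp (-x))) atTop
        (𝓝 (∑ u ∈ Finset.range (l + 1), (p : ℝ) ^ u * 0)) :=
      tendsto_finsetSum _ fun u _ =>
        (Real.tendsto_pow_mul_exp_neg_atTop_nhds_zero u).const_mul _
    simp only [mul_zero, Finset.sum_const_zero] at h
    refine (h.comp hl).congr fun c => ?_
    rw [sSum, Finset.mul_sum]
    refine Finset.sum_congr rfl fun u _ => ?_
    rw [rat, mul_pow]; ring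

end

end ColoredShuffle

namespace ColoredShuffle

noncomputable section

/-! ### Limits of the distances -/

variable {p m : ℕ}

theorem tendsto_dens (hm : 1 ≤ m) (c : ℝ) (l : ℕ) :
    Tendsto (fun n => dens p (windowLaw m c n) l) atTop (𝓝 (sSum p c l)) := by
  rw [sSum, Finset.mul_sum]
  refine tendsto_finsetSum _ fun u _ => ?_
  have h := (tendsto_windowLaw hm c u).mul_const (u.factorial * (p : ℝ) ^ u)
  have h2 : Real.exp (-lam c) * (lam c ^ u / u.factorial) * (u.factorial * (p : ℝ) ^ u) =
      Real.exp (-lam c) * rat p c ^ u := by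
    rw [rat, mul_pow]; field_simp
  rwa [h2] at h

theorem windowLaw_mul_le {n : ℕ} (hm : 1 ≤ m) (hn : m ≤ n) (c : ℝ) (u : ℕ) :
    windowLaw m c n u * (u.factorial * (p : ℝ) ^ u) ≤ (rat p c * Real.exp (m / n)) ^ u := by
  calc windowLaw m c n u * (u.factorial * (p : ℝ) ^ u)
      ≤ (lam c * Real.exp (m / n)) ^ u / u.factorial * (u.factorial * (p : ℝ) ^ u) :=
        mul_le_mul_of_nonneg_right (windowLaw_le hm hn c u) (by positivity)
    _ = (rat p c * Real.exp (m / n)) ^ u := by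
        rw [rat, mul_pow, mul_pow, mul_pow]; field_simp

theorem dens_windowLaw_nonneg {n : ℕ} (hn : m ≤ n) (c : ℝ) (l : ℕ) :
    0 ≤ dens p (windowLaw m c n) l :=
  Finset.sum_nonneg fun u _ => mul_nonneg (windowLaw_nonneg hn c u) (by positivity)

/-- The top density dominates the density at any fixed level `l`, whose limit is at least `(l + 1) *
exp (-λ)`. -/
theorem tendsto_dens_top_atTop (hm : 1 ≤ m) (c : ℝ) (hr : 1 ≤ rat p c) :
    Tendsto (fun n => dens p (windowLaw m c n) n) atTop atTop := by
  refine tendsto_atTop.2 fun b => ?_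
  obtain ⟨l, hl⟩ := exists_nat_gt (b / Real.exp (-lam c))
  have h1 : b < sSum p c l := by
    rw [div_lt_iff₀' (Real.exp_pos _)] at hl
    refine hl.trans_le (mul_le_mul_of_nonneg_left ?_ (Real.exp_pos _).le)
    calc (l : ℝ) ≤ ∑ u ∈ Finset.range (l + 1), (1 : ℝ) := by simp
      _ ≤ _ := Finset.sum_le_sum fun u _ => one_le_pow₀ hr
  filter_upwards [(tendsto_dens hm c l).eventually_const_lt h1, eventually_ge_atTop m,
    eventually_ge_atTop l] with n hn hnm hnl
  exact hn.le.trans (dens_mono (windowLaw_nonneg hnm c) hnl)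

variable [NeZero p]

theorem dens_windowLaw_le {n : ℕ} (hm : 1 ≤ m) (hn : m ≤ n) (c : ℝ) (l : ℕ) :
    dens p (windowLaw m c n) l ≤ (1 + rat p c * Real.exp m) ^ l := by
  have hr := rat_pos (p := p) c
  refine le_trans (Finset.sum_le_sum fun u _ => (windowLaw_mul_le hm hn c u).trans ?_)
    (geom_sum_le_one_add_pow (by positivity) l)
  have : (m : ℝ) / n ≤ m :=
    div_le_self (Nat.cast_nonneg m) (by exact_mod_cast hm.trans hn)
  gcongr

theorem tendsto_levelWt (p l : ℕ) : Tendsto (fun n => levelWt n p l) atTop (𝓝 (aCoef p l)) := by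
  refine tendsto_const_nhds.congr' ?_
  filter_upwards [eventually_gt_atTop l] with n hn
  rw [levelWt, if_pos hn]

/-- Convergence of the `U`-average of a continuous function of the density. -/
theorem summable_and_tendsto_tsum_levelWt (hm : 1 ≤ m) (c : ℝ) {φ : ℝ → ℝ} (hφ : Continuous φ)
    {C : ℝ} (h : ∀ (l : ℕ) (d : ℝ), 0 ≤ d → d ≤ (1 + rat p c * Real.exp m) ^ l →
      |φ d| ≤ C ^ l) :
    Summable (fun l => aCoef p l * φ (sSum p c l)) ∧
    Tendsto (fun n => ∑' l, levelWt n p l * φ (dens p (windowLaw m c n) l)) atTop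
      (𝓝 (∑' l, aCoef p l * φ (sSum p c l))) := by
  constructor
  · refine summable_of_abs_le_pow aCoef_nonneg aCoef_le fun l => h l _ (sSum_pos c l).le ?_
    have hr := rat_pos (p := p) c
    refine (sSum_le c l).trans (pow_le_pow_left₀ (by positivity) ?_ l)
    have : 1 ≤ Real.exp m := Real.one_le_exp (Nat.cast_nonneg m)
    nlinarith
  -- The level weights are at most `1 / l!` uniformly in `n`, while `φ` of the density grows at most
  -- like `C ^ l`.
  · refine tendsto_tsum_of_dominated_convergence (bound := fun l => C ^ l / l.factorial)
      (hasSum_exp C).summable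
      (fun l => (tendsto_levelWt p l).mul ((hφ.tendsto _).comp (tendsto_dens hm c l))) ?_
    filter_upwards [eventually_ge_atTop m] with n hn l
    rw [norm_mul, Real.norm_of_nonneg (levelWt_nonneg l), Real.norm_eq_abs, ← one_div_mul_eq_div]
    exact mul_le_mul (levelWt_le l)
      (h l _ (dens_windowLaw_nonneg hn c l) (dens_windowLaw_le hm hn c l)) (abs_nonneg _)
      (by positivity)

theorem stepLaw_windowTime {n : ℕ} (hn : m ≤ n) (c : ℝ) :
    stepLaw n p m (windowTime m c n) = mix n p (windowLaw m c n) :=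
  stepLaw_eq_mix hn _

theorem one_le_bound (p m : ℕ) [NeZero p] (c : ℝ) (l : ℕ) :
    1 ≤ (1 + rat p c * Real.exp m) ^ l := by
  have hr := rat_pos (p := p) c
  exact one_le_pow₀ (by linarith [mul_pos hr (Real.exp_pos m)])

theorem summable_and_tendsto_rpow (hm : 1 ≤ m) (c : ℝ) {q : ℝ} (hq : 1 ≤ q) :
    Summable (hqTerm q p c) ∧
    Tendsto (fun n => ∑' l, levelWt n p l * |dens p (windowLaw m c n) l - 1| ^ q) atTop
      (𝓝 (hqProf q p c)) := by
  refine summable_and_tendsto_tsum_levelWt (φ := fun d => |d - 1| ^ q)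
    (C := (1 + rat p c * Real.exp m) ^ q) hm c ?_ fun l d hd hd' => ?_
  · exact (continuous_id.sub continuous_const).abs.rpow_const fun x => Or.inr (by linarith)
  · have hr := rat_pos (p := p) c
    rw [abs_of_nonneg (Real.rpow_nonneg (abs_nonneg _) _), ← Real.rpow_natCast,
      ← Real.rpow_mul (by positivity), mul_comm q, Real.rpow_mul (by positivity),
      Real.rpow_natCast]
    exact Real.rpow_le_rpow (abs_nonneg _) (abs_sub_one_le hd hd' (one_le_bound p m c l))
      (by linarith)

theorem abs_mul_log_le {d B : ℝ} (hd : 0 ≤ d) (hdB : d ≤ B) (hB : 1 ≤ B) :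
    |d * Real.log d| ≤ B ^ 2 := by
  rcases le_or_gt d 1 with h | h
  · rcases hd.eq_or_lt with h0 | h0
    · rw [← h0]; simp; positivity
    · have := Real.abs_log_mul_self_lt d h0 h
      rw [mul_comm]
      nlinarith
  · have h1 := Real.log_le_sub_one_of_pos (by linarith : 0 < d)
    have h2 := Real.log_nonneg h.le
    rw [abs_of_nonneg (mul_nonneg hd h2)]
    nlinarith

theorem summable_and_tendsto_entropy (hm : 1 ≤ m) (c : ℝ) :
    Summable (entTerm p c) ∧
    Tendsto (fun n => ∑' l, levelWt n p l *
      (dens p (windowLaw m c n) l * Real.log (dens p (windowLaw m c n) l))) atTop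
      (𝓝 (entProf p c)) := by
  refine summable_and_tendsto_tsum_levelWt (φ := fun d => d * Real.log d)
    (C := (1 + rat p c * Real.exp m) ^ 2) hm c Real.continuous_mul_log fun l d hd hd' => ?_
  rw [← pow_mul, mul_comm 2 l, pow_mul]
  exact abs_mul_log_le hd hd' (one_le_bound p m c l)

theorem tendsto_lqNorm (hm : 1 ≤ m) (c : ℝ) {q : ℝ} (hq : 1 ≤ q) :
    Tendsto (fun n : ℕ => lqNorm (unif (ColPerm n p)) q
      (relDev (stepLaw n p m (windowTime m c n)) (unif (ColPerm n p))) ^ q) atTop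
      (𝓝 (hqProf q p c)) := by
  refine (summable_and_tendsto_rpow hm c hq).2.congr' ?_
  filter_upwards [eventually_ge_atTop m] with n hn
  rw [stepLaw_windowTime hn, lqNorm_rpow_mix hq]

theorem tendsto_relEnt (hm : 1 ≤ m) (c : ℝ) :
    Tendsto (fun n : ℕ => relEnt (stepLaw n p m (windowTime m c n)) (unif (ColPerm n p))) atTop
      (𝓝 (entProf p c)) := by
  refine (summable_and_tendsto_entropy hm c).2.congr' ?_
  filter_upwards [eventually_ge_atTop m] with n hn
  rw [stepLaw_windowTime hn, relEnt_mix]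

theorem tendsto_tvDist (hm : 1 ≤ m) (c : ℝ) :
    Tendsto (fun n : ℕ => tvDist (stepLaw n p m (windowTime m c n)) (unif (ColPerm n p))) atTop
      (𝓝 (fProf p c)) := by
  have h := (summable_and_tendsto_rpow (p := p) hm c le_rfl).2.const_mul (1 / 2)
  have h1 : hqProf 1 p c = 2 * fProf p c := by
    rw [← (hasSum_aCoef_mul_abs c).tsum_eq]
    simp only [hqProf, hqTerm, Real.rpow_one]
  rw [h1, ← mul_assoc, one_div_mul_cancel two_ne_zero, one_mul] at h
  refine h.congr' ?_
  filter_upwards [eventually_ge_atTop m] with n hn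
  simp only [stepLaw_windowTime hn, tvDist_mix, Real.rpow_one]

/-- The smallest level attained for large decks. -/
def minLevel (p : ℕ) : ℕ := if p = 1 then 1 else 0

theorem minLevel_le_level {n : ℕ} (hn : 1 ≤ n) (x : ColPerm n p) : minLevel p ≤ level x := by
  unfold minLevel
  split_ifs with h
  · subst h; exact one_le_level hn x
  · exact Nat.zero_le _

theorem exists_level_eq_minLevel {n : ℕ} (hn : 2 ≤ n) :
    ∃ x : ColPerm n p, level x = minLevel p := by
  have hp : 1 ≤ p := NeZero.one_le
  unfold minLevel
  split_ifs with h
  · exact exists_level_eq (by omega) (aCoef_pos 1 (Or.inr le_rfl))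
  · exact exists_level_eq (by omega) (aCoef_pos 0 (Or.inl (by omega)))

theorem sepProf_eq (p : ℕ) (c : ℝ) : sepProf p c = 1 - sSum p c (minLevel p) := by
  unfold sepProf minLevel
  split_ifs with h
  · subst h; simp [sSum, Finset.sum_range_succ, rat]
  · simp [sSum]

theorem tendsto_sep (hm : 1 ≤ m) (c : ℝ) :
    Tendsto (fun n : ℕ => sep (stepLaw n p m (windowTime m c n)) (unif (ColPerm n p))) atTop
      (𝓝 (sepProf p c)) := by
  rw [sepProf_eq]
  refine ((tendsto_dens hm c (minLevel p)).const_sub 1).congr' ?_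
  filter_upwards [eventually_ge_atTop m, eventually_ge_atTop 2] with n hn hn2
  rw [stepLaw_windowTime hn, sep_mix (windowLaw_nonneg hn c)
    (minLevel_le_level (by omega)) (exists_level_eq_minLevel hn2)]

theorem tendsto_dens_top (hm : 1 ≤ m) (c : ℝ) (hr : rat p c < 1) :
    Tendsto (fun n => dens p (windowLaw m c n) n) atTop
      (𝓝 (Real.exp (-lam c) / (1 - rat p c))) := by
  have hr0 := rat_pos (p := p) c
  have h1 : Tendsto (fun n => ∑' u : ℕ, windowLaw m c n u * (u.factorial * (p : ℝ) ^ u)) atTop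
      (𝓝 (∑' u : ℕ, Real.exp (-lam c) * rat p c ^ u)) := by
    -- The terms are at most `(r * exp (m / n)) ^ u`. Since `r < (1 + r) / 2 < 1`, this midpoint
    -- eventually bounds the ratio.
    refine tendsto_tsum_of_dominated_convergence
      (bound := fun u => ((1 + rat p c) / 2) ^ u)
      (summable_geometric_of_lt_one (by linarith) (by linarith)) (fun u => ?_) ?_
    · have h := (tendsto_windowLaw hm c u).mul_const (u.factorial * (p : ℝ) ^ u)
      have h2 : Real.exp (-lam c) * (lam c ^ u / u.factorial) * (u.factorial * (p : ℝ) ^ u) =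
          Real.exp (-lam c) * rat p c ^ u := by
        rw [rat, mul_pow]; field_simp
      rwa [h2] at h
    · have h2 := ((tendsto_exp_div m).const_mul (rat p c)).eventually_le_const
        (by linarith : rat p c * 1 < (1 + rat p c) / 2)
      filter_upwards [h2, eventually_ge_atTop m] with n hn hnm u
      rw [Real.norm_of_nonneg (mul_nonneg (windowLaw_nonneg hnm c u) (by positivity))]
      exact (windowLaw_mul_le hm hnm c u).trans (pow_le_pow_left₀ (by positivity) hn u)
  rw [tsum_mul_left, tsum_geometric_of_lt_one hr0.le hr, ← div_eq_mul_inv] at h1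
  refine h1.congr fun n => ?_
  rw [dens]
  refine tsum_eq_sum fun u hu => ?_
  rw [windowLaw, undrawn_support _ _ u (by simpa [Nat.lt_succ_iff] using hu), zero_mul]

theorem one_sub_mul_exp_le {x : ℝ} (h0 : 0 ≤ x) (h1 : x ≤ 1) :
    (1 - x) * Real.exp x ≤ 1 - x ^ 2 / 2 := by
  have h := Real.exp_bound' h0 h1 (n := 3) (by norm_num)
  simp [Finset.sum_range_succ, Nat.factorial] at h
  have h2 := mul_le_mul_of_nonneg_left h (sub_nonneg.2 h1)
  refine h2.trans ?_
  have h3 : 0 ≤ x ^ 3 := by positivity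
  have h4 : 0 ≤ x ^ 4 := by positivity
  nlinarith

/-- Decides the maximum in `linfNorm_mix`: in the limit the excess at the identity is at least the
deficit at the lowest level. For `p ≥ 2` it is enough that `exp (-λ) ≥ 1 - λ ≥ 1 - r / 2`; for `p =
1` the second-order bound `one_sub_mul_exp_le` is needed. -/
theorem sepProf_le (c : ℝ) (hr : rat p c < 1) :
    sepProf p c ≤ Real.exp (-lam c) / (1 - rat p c) - 1 := by
  have hl := lam_pos c
  have hp : 1 ≤ p := NeZero.one_le
  have h1r : 0 < 1 - rat p c := by linarith
  unfold sepProf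
  split_ifs with h
  · subst h
    have hr1 : rat 1 c = lam c := by simp [rat]
    rw [hr1] at hr h1r ⊢
    have h1 := one_sub_mul_exp_le hl.le hr.le
    have h2 : Real.exp (-lam c) * Real.exp (lam c) = 1 := by
      rw [← Real.exp_add, neg_add_cancel, Real.exp_zero]
    have h3 : 1 - lam c ≤ Real.exp (-lam c) * (1 - lam c ^ 2 / 2) := by
      have := mul_le_mul_of_nonneg_left h1 (Real.exp_pos (-lam c)).le
      nlinarith
    rw [le_sub_iff_add_le, le_div_iff₀ h1r]
    nlinarith
  · have hp2 : (2 : ℝ) ≤ p := by exact_mod_cast (by omega : 2 ≤ p)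
    have h1 : 2 * lam c ≤ rat p c := mul_le_mul_of_nonneg_right hp2 hl.le
    have h2 := Real.one_sub_le_exp_neg (lam c)
    rw [le_sub_iff_add_le, le_div_iff₀ h1r]
    nlinarith [sq_nonneg (rat p c)]

theorem tendsto_linfNorm (hm : 1 ≤ m) (c : ℝ) :
    Tendsto (fun n : ℕ => ((linfNorm
      (relDev (stepLaw n p m (windowTime m c n)) (unif (ColPerm n p))) : ℝ) : EReal)) atTop
      (𝓝 (hinfProf p c)) := by
  have heq : (fun n => max (dens p (windowLaw m c n) n - 1)
      (1 - dens p (windowLaw m c n) (minLevel p))) =ᶠ[atTop] fun n => linfNorm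
        (relDev (stepLaw n p m (windowTime m c n)) (unif (ColPerm n p))) := by
    filter_upwards [eventually_ge_atTop m, eventually_ge_atTop 2] with n hn hn2
    rw [stepLaw_windowTime hn, linfNorm_mix (windowLaw_nonneg hn c)
      (minLevel_le_level (by omega)) (exists_level_eq_minLevel hn2)]
  unfold hinfProf
  split_ifs with hr
  · have h := ((tendsto_dens_top hm c hr).sub_const 1).max
      ((tendsto_dens (p := p) hm c (minLevel p)).const_sub 1)
    rw [← sepProf_eq, max_eq_left (sepProf_le c hr)] at h
    exact (continuous_coe_real_ereal.tendsto _).comp (h.congr' heq)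
  · rw [EReal.tendsto_coe_nhds_top_iff]
    refine Tendsto.congr' heq (tendsto_atTop_mono (fun n => le_max_left _ _) ?_)
    exact tendsto_atTop_add_const_right _ _ (tendsto_dens_top_atTop hm c (not_lt.1 hr))

/-! ### Monotonicity in time -/

section Monotone

variable {X : Type*} [Fintype X] [Group X]

theorem tvDist_convol_unif_le {M N : X → ℝ} (hN : ∀ x, 0 ≤ N x) (hN1 : ∑ x, N x = 1) :
    tvDist (convol M N) (unif X) ≤ tvDist M (unif X) := by
  unfold tvDist
  refine mul_le_mul_of_nonneg_left ?_ (by norm_num)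
  have h1 : ∀ z, |convol M N z - unif X z| ≤ convol (fun x => |M x - unif X x|) N z := by
    intro z
    have h2 : convol M N z - unif X z = ∑ u, (M (z * u⁻¹) - unif X (z * u⁻¹)) * N u := by
      simp only [sub_mul, Finset.sum_sub_distrib, convol]
      congr 1
      simp only [unif, ← Finset.mul_sum, hN1, mul_one]
    rw [h2]
    refine (Finset.abs_sum_le_sum_abs _ _).trans (Finset.sum_le_sum fun u _ => ?_)
    rw [abs_mul, abs_of_nonneg (hN u)]
  refine (Finset.sum_le_sum fun z _ => h1 z).trans ?_
  rw [sum_convol, hN1, mul_one]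

end Monotone

theorem antitone_tvDist_stepLaw (n p m : ℕ) [NeZero p] :
    Antitone fun k => tvDist (stepLaw n p m k) (unif (ColPerm n p)) :=
  antitone_nat_of_succ_le fun _ => tvDist_convol_unif_le
    (Set.indicator_nonneg fun _ _ => by positivity) (sum_topUnif _)

/-- Inherited in the limit from monotonicity of total variation in time. The profile does not depend
on `m`, so the walk with `m = 1` serves. -/
theorem antitone_fProf (p : ℕ) [NeZero p] : Antitone (fProf p) := by
  intro c c' hc
  refine le_of_tendsto_of_tendsto' (tendsto_tvDist le_rfl c') (tendsto_tvDist le_rfl c) fun n => ?_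
  refine antitone_tvDist_stepLaw n p 1 (Nat.floor_mono ?_)
  exact mul_le_mul_of_nonneg_left (by linarith) (by positivity)

theorem hasCutoff_tvDist (hm : 1 ≤ m) :
    HasCutoff (fun n k => tvDist (stepLaw n p m k) (unif (ColPerm n p)))
      (fun n => (n : ℝ) / m * Real.log n) (fun n => (n : ℝ) / m) := by
  refine ⟨fProf p, antitone_fProf p, fProf_mem_Icc, tendsto_fProf_atBot, tendsto_fProf_atTop,
    fun c => (tendsto_tvDist hm c).congr fun n => ?_⟩
  have : (n : ℝ) / m * Real.log n + c * ((n : ℝ) / m) = n / m * (Real.log n + c) := by ring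
  simp only [this, windowTime]

end

end ColoredShuffle

theorem theorem1p3 (p m : ℕ) [NeZero p] (hm : 1 ≤ m) :
    (∀ c : ℝ,
      -- separation
      Tendsto (fun n : ℕ => sep (stepLaw n p m (windowTime m c n)) (unif (ColPerm n p)))
        atTop (𝓝 (sepProf p c)) ∧
      -- `L^q(U)` for finite `q`
      (∀ q : ℝ, 1 ≤ q →
        Summable (hqTerm q p c) ∧
        Tendsto
          (fun n : ℕ => lqNorm (unif (ColPerm n p)) q
            (relDev (stepLaw n p m (windowTime m c n)) (unif (ColPerm n p))) ^ q)
          atTop (𝓝 (hqProf q p c))) ∧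
      -- relative entropy
      Summable (entTerm p c) ∧
      Tendsto (fun n : ℕ => relEnt (stepLaw n p m (windowTime m c n)) (unif (ColPerm n p)))
        atTop (𝓝 (entProf p c)) ∧
      -- `L^∞(U)`
      Tendsto
        (fun n : ℕ => ((linfNorm
          (relDev (stepLaw n p m (windowTime m c n)) (unif (ColPerm n p))) : ℝ) : EReal))
        atTop (𝓝 (hinfProf p c)) ∧
      -- total variation
      Tendsto (fun n : ℕ => tvDist (stepLaw n p m (windowTime m c n)) (unif (ColPerm n p)))
        atTop (𝓝 (fProf p c)) ∧
      -- chi-squared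
      hqProf 2 p c = gProf p c ∧
      Tendsto (fun n : ℕ => chiSq (stepLaw n p m (windowTime m c n)) (unif (ColPerm n p)))
        atTop (𝓝 (gProf p c))) ∧
    -- total-variation cutoff at `(n/m) log n` with window `n/m`
    HasCutoff (fun n k => tvDist (stepLaw n p m k) (unif (ColPerm n p)))
      (fun n => (n : ℝ) / m * Real.log n) (fun n => (n : ℝ) / m) := by
  refine ⟨fun c => ⟨tendsto_sep hm c, fun q hq => ⟨(summable_and_tendsto_rpow hm c hq).1,
    tendsto_lqNorm hm c hq⟩, (summable_and_tendsto_entropy hm c).1, tendsto_relEnt hm c,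
    tendsto_linfNorm hm c, tendsto_tvDist hm c, hqProf_two c, ?_⟩, hasCutoff_tvDist hm⟩
  have h := tendsto_lqNorm (p := p) hm c one_le_two
  rw [hqProf_two] at h
  simpa only [chiSq, Real.rpow_two] using h
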